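/- Let $a,b,c\ge 1$ be integers. Represent the lozenge tilings of the hexagon with side lengths $a,b,c,a,b,c$ (with the two $c$ sides vertical) by families of $c$ nonintersecting lattice paths, numbered from the bottom, from the left $c$ side to the right $c$ side. Each path has points in the columns $x=0,1,\dots,a+b$ and makes $a$ up steps (height $+\tfrac12$) and $b$ down steps (height $-\tfrac12$); path $i+1$ starts and ends one unit above path $i$. Let $\mathcal X$ be the finite set of all these families. The Luby–Randall–Sinclair chain on $\mathcal X$, with tower moves parallel to the $c$ sides, makes the following step. Choose uniformly one of the $c(a+b-1)$ internal points of the paths, say the point of path $i$ in column $x$, and choose one of the directions up, down with probability $\tfrac12$ each. Let $k\ge 0$ be the number of paths blocking the movement of path $i$ at $x$ in this direction, i.e. the paths stacked in column $x$ at unit distances directly above (respectively below) path $i$. If moving the points in column $x$ of these $k+1$ paths by one unit in the chosen direction yields an element of $\mathcal X$, then this move is made with probability $\frac1{k+1}$; otherwise the state does not change. Let $P$ be the transition matrix. The stationary distribution is uniform, and the separation distance is $s(t)=\max_{X,Y\in\mathcal X}\bigl(1-|\mathcal X|\,P^t(X,Y)\bigr)$. Let $S_x$ be the total height of the $c$ paths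 in column $x$, and put $$\Phi=\sum_{x=0}^{a+b}\bigl(S_x-E[S_x]\bigr)\sin\frac{\pi x}{a+b},$$ where $E$ and $\operatorname{Var}$ refer to a uniformly random state. Let $\hat 1$ be the top state, in which every path makes all its up steps first. Then $$\frac{\Phi(\hat 1)^2}{\operatorname{Var}[\Phi]}=\frac{c\,[(a+b)^2-1]}{ab(a+b+c)}\cdot\frac{\sin^2(\pi a/(a+b))}{1-\cos(\pi/(a+b))}.$$ Moreover, let $\lambda$ be the second largest eigenvalue of $P$ in absolute value (the largest in absolute value among the eigenvalues other than $1$). If $\lambda$ has multiplicity one, then $A_s=\Phi(\hat 1)^2/\operatorname{Var}[\Phi]$ is the constant of the separation distance, that is, $$s(t)=(1+o(1))\,A_s\,|\lambda|^t\qquad(t\to\infty).$$ -/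

import Mathlib

open Finset Filter Topology Asymptotics
open scoped BigOperators

noncomputable section

namespace LozengeChain

/-! ### Lozenge tilings of the hexagon as nonintersecting lattice paths

The hexagon has side lengths `a, b, c, a, b, c` and its two `c` sides are vertical.  A lozenge
tiling is encoded by `c` nonintersecting lattice paths running from the left `c` side to the right
`c` side, one through each unit edge.  The lozenges having two vertical sides are the steps of the
paths: `a` up steps (by `+1/2`) and `b` down steps (by `-1/2`) on each path.  The remaining
lozenges are the dots not visited by any path. -/

/-- `u i x` records the position of path `i` (numbered from the bottom) in column `x`, where
`x = 0, …, a + b`.  The number `u i x - i` is the number of up steps of path `i` before column `x`,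
so an up step adds `1` to `u i`, a down step leaves it unchanged, and the geometric height is
`u i x - x / 2` (see `height`). -/
structure IsRouting {a b c : ℕ} (u : Fin c → Fin (a + b + 1) → ℤ) : Prop where
  /-- Path `i` starts at the `i`-th unit edge of the left side. -/
  start : ∀ i, u i 0 = (i : ℕ)
  /-- Path `i` ends at the `i`-th unit edge of the right side, having made `a` up steps. -/
  finish : ∀ i, u i (Fin.last (a + b)) = (i : ℕ) + a
  /-- Every step is a down step or an up step. -/
  step : ∀ i (x : Fin (a + b)), u i x.succ = u i x.castSucc ∨ u i x.succ = u i x.castSucc + 1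
  /-- The paths do not intersect. -/
  disjoint : ∀ i j, i < j → ∀ x, u i x < u j x

/-- The state space: all lozenge tilings of the `a, b, c, a, b, c` hexagon, in the lattice path
representation.  It carries the pointwise partial order of the paths. -/
abbrev Routing (a b c : ℕ) : Type := {u : Fin c → Fin (a + b + 1) → ℤ // IsRouting u}

instance finiteRouting (a b c : ℕ) : Finite (Routing a b c) := by
  have hfin : Set.Finite {u : Fin c → Fin (a + b + 1) → ℤ |
      ∀ i : Fin c, u i ∈ {w : Fin (a + b + 1) → ℤ |
        ∀ x, w x ∈ Set.Icc ((i : ℕ) : ℤ) ((i : ℕ) + a)}} :=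
    Set.Finite.pi' fun i => Set.Finite.pi' fun _ => Set.finite_Icc _ _
  refine Set.Finite.subset hfin ?_
  intro u (hu : IsRouting u) i x
  have hm : Monotone (u i) := Fin.monotone_iff_le_succ.2 fun y => by
    rcases hu.step i y with h | h <;> omega
  exact ⟨(hu.start i).symm.le.trans (hm (Fin.zero_le x)),
    (hm (Fin.le_last x)).trans (hu.finish i).le⟩

instance fintypeRouting (a b c : ℕ) : Fintype (Routing a b c) := Fintype.ofFinite _

/-- The top state: every path makes its `a` up steps first. -/
def topRouting (a b c : ℕ) : Routing a b c :=
  ⟨fun i x => (i : ℕ) + min (x : ℕ) a, by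
    refine ⟨fun i => by simp, fun i => by simp, fun i x => ?_, fun i j h x => ?_⟩
    · simp only [Fin.val_succ, Fin.val_castSucc]
      omega
    · have : (i : ℕ) < j := h
      omega⟩

/-- The top state is the greatest element; it is the state denoted `1̂`. -/
instance orderTopRouting (a b c : ℕ) : OrderTop (Routing a b c) where
  top := topRouting a b c
  le_top v := by
    intro i x
    change v.1 i x ≤ (i : ℕ) + min (x : ℕ) a
    have h1 : ∀ x : Fin (a + b + 1), v.1 i x ≤ (i : ℕ) + (x : ℕ) := by
      intro x
      induction x using Fin.induction with
      | zero => simp [v.2.start i]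
      | succ y ih =>
        rcases v.2.step i y with h | h <;>
          simp only [Fin.val_succ, Fin.val_castSucc] at ih ⊢ <;> push_cast <;> omega
    have hm : Monotone (v.1 i) := Fin.monotone_iff_le_succ.2 fun y => by
      rcases v.2.step i y with h | h <;> omega
    have h2 := (hm (Fin.le_last x)).trans (v.2.finish i).le
    have h3 := h1 x
    omega

/-! ### The Luby-Randall-Sinclair chain -/

/-- The tower pushed together with path `i` in column `x`: path `i` itself and the paths that block
its movement upwards (if `up = true`) or downwards (if `up = false`), that is, the paths stacked
directly on top of it, respectively directly below it, at unit distances. -/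
def tower {a b c : ℕ} (u : Routing a b c) (i : Fin c) (x : Fin (a + b + 1)) (up : Bool) :
    Finset (Fin c) :=
  univ.filter fun j => (if up then i ≤ j else j ≤ i) ∧ u.1 j x - u.1 i x = ((j : ℕ) : ℤ) - ((i : ℕ) : ℤ)

/-- The result of moving the tower of path `i` in column `x` by one unit up or down.  This need not
be a routing: for example when path `i` has no local extremum of the right type at `x`. -/
def pushed {a b c : ℕ} (u : Routing a b c) (i : Fin c) (x : Fin (a + b + 1)) (up : Bool) :
    Fin c → Fin (a + b + 1) → ℤ :=
  fun j y => if j ∈ tower u i x up ∧ y = x then u.1 j y + (if up then 1 else -1) else u.1 j y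

open Classical in
/-- The probability of going from `u` to `v` once the point of path `i` in column `x` and the
direction have been selected.  If there are `k` blocking paths, so that the tower has `k + 1`
elements, and if the move is possible, then it is made with probability `1 / (k + 1)`; otherwise
nothing happens. -/
def pushProb {a b c : ℕ} (u : Routing a b c) (i : Fin c) (x : Fin (a + b + 1)) (up : Bool)
    (v : Routing a b c) : ℝ :=
  if IsRouting (pushed u i x up) then
    (if v.1 = pushed u i x up then 1 / ((tower u i x up).card : ℝ) else 0) +
      (if v = u then 1 - 1 / ((tower u i x up).card : ℝ) else 0)
  else if v = u then 1 else 0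

/-- The internal points of the paths. -/
def sites (a b c : ℕ) : Finset (Fin c × Fin (a + b + 1)) :=
  univ.filter fun s => s.2 ≠ 0 ∧ s.2 ≠ Fin.last (a + b)

/-- The transition matrix: pick a uniformly random internal point of the paths, pick one of the two
directions with probability `1/2` each, and try to push. -/
def transition (a b c : ℕ) : Matrix (Routing a b c) (Routing a b c) ℝ :=
  Matrix.of fun u v =>
    ∑ s ∈ sites a b c, ∑ up : Bool, (1 / ((sites a b c).card : ℝ)) * (1 / 2) *
      pushProb u s.1 s.2 up v

/-! ### Second eigenvalue and separation distance of a finite chain -/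

/-- `lam` is the second largest eigenvalue in absolute value of the transition matrix `P` of a
connected chain (whose eigenvalue `1` is simple). -/
def IsSecondEigenvalue {X : Type*} [Fintype X] [DecidableEq X] (P : Matrix X X ℝ) (lam : ℝ) :
    Prop :=
  Module.End.HasEigenvalue (Matrix.toLin' P) lam ∧ lam ≠ 1 ∧
    ∀ nu : ℝ, Module.End.HasEigenvalue (Matrix.toLin' P) nu → nu ≠ 1 → |nu| ≤ |lam|

/-- The eigenvalue `lam` of `P` has multiplicity one. -/
def HasMultiplicityOne {X : Type*} [Fintype X] [DecidableEq X] (P : Matrix X X ℝ) (lam : ℝ) :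
    Prop :=
  Module.finrank ℝ (Module.End.eigenspace (Matrix.toLin' P) lam) = 1

/-- The separation distance `s(t) = max_{x,y} (μ(y) - P_x^t(y)) / μ(y)` from the uniform
distribution `μ` on the finite nonempty state space. -/
def separation {X : Type*} [Fintype X] [DecidableEq X] [Nonempty X] (P : Matrix X X ℝ) (t : ℕ) :
    ℝ :=
  univ.sup' univ_nonempty fun p : X × X =>
    (1 / (Fintype.card X : ℝ) - (P ^ t) p.1 p.2) / (1 / (Fintype.card X : ℝ))

/-- `A` is the constant of the separation distance for `lam`: `s(t) = (1 + o(1)) A |lam|^t` as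
`t → ∞`. -/
def IsSeparationConstant {X : Type*} [Fintype X] [DecidableEq X] [Nonempty X]
    (P : Matrix X X ℝ) (lam A : ℝ) : Prop :=
  (fun t : ℕ => separation P t) ~[atTop] fun t : ℕ => A * |lam| ^ t

/-! ### The potential function -/

/-- The height of path `i` in column `x`; it changes by `±1/2` at each step. -/
def height {a b c : ℕ} (u : Routing a b c) (i : Fin c) (x : Fin (a + b + 1)) : ℝ :=
  (u.1 i x : ℝ) - (x : ℕ) / 2

/-- The total height in column `x`. -/
def columnHeight {a b c : ℕ} (x : Fin (a + b + 1)) (u : Routing a b c) : ℝ :=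
  ∑ i, height u i x

/-- The expectation of `f` at a uniformly random state. -/
def mean {X : Type*} [Fintype X] (f : X → ℝ) : ℝ := (∑ x, f x) / (Fintype.card X : ℝ)

/-- The variance of `f` at a uniformly random state. -/
def variance {X : Type*} [Fintype X] (f : X → ℝ) : ℝ := mean fun x => (f x - mean f) ^ 2

/-- The potential function `Φ = ∑ₓ (Sₓ - E[Sₓ]) sin (π x / (a + b))`, where `Sₓ` is the total height
in column `x`, and the columns are numbered `0, …, a + b` from the left. -/
def potential {a b c : ℕ} (u : Routing a b c) : ℝ :=
  ∑ x : Fin (a + b + 1), (columnHeight x u - mean (columnHeight (a := a) (b := b) (c := c) x)) *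
    Real.sin (Real.pi * (x : ℕ) / ((a : ℝ) + b))

end LozengeChain

end

noncomputable section

namespace LozengeChain

/-! ### Pushing towers -/

section Push

variable {a b c : ℕ}

/-! Eigenfunction. A tower of `k + 1` points moves with probability `1 / (k + 1)`, so an admissible
push changes the expected total height of its column by exactly `±1`. Summed over paths and
directions, the action on the total height in column `x` is therefore the discrete Laplacian in `x`,
however the paths block each other (`colOp_columnHeight`). The sine weights form the Dirichlet
eigenvector of this Laplacian, so `potential` is an eigenfunction of `transition`, with eigenvalue
`potentialEigenvalue` (`transition_mulVec_potential`).

It is the second eigenvalue. The chain maps monotone functions to monotone functions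
(`transition_mulVec_mono`) and `potential` is strictly monotone. Comparing increments of a
nonconstant eigenfunction with those of `potential` bounds its eigenvalue in absolute value
(`abs_le_of_monotone_chain`). Holding probabilities of at least `1 / 2` exclude negative eigenvalues
(`half_le_transition_self`, `nonneg_of_lazy_chain`).

Separation. The matrix is symmetric. If the second eigenvalue `λ` is simple, expansion in an
orthonormal eigenbasis gives `1 - |X| P^t(x, y) = -Φ(x) Φ(y) / Var Φ * λ^t + o(λ^t)`. The
coefficient is largest at the pair (top, bottom), because `Φ(bottom) = -Φ(top)` and these are the
extreme values (`isSeparationConstant_of_simple`).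

The explicit value. `Φ(top)` follows by summation by parts, since the column heights of the top
state have a single kink, at column `a`. For the variance, reversibility makes the covariances of
the column heights harmonic off the diagonal, hence equal to `x (a + b - y)` for `x ≤ y` up to one
constant (`heightCov_eq`). That constant comes from the variance in column `1`, where the paths
occupy `{0, …, c}` minus one gap. The product formula `card_walk_eq` shows that the gap has a
beta-binomial law, whose first two moments give `heightCov_one_one`. -/

lemma le_sub_of_strictMono {A : Fin c → ℤ} (hA : StrictMono A) {i j : Fin c} (hij : i ≤ j) :
    ((j : ℕ) : ℤ) - ((i : ℕ) : ℤ) ≤ A j - A i := by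
  have key : ∀ d : ℕ, ∀ j : Fin c, (j : ℕ) = i + d → (d : ℤ) ≤ A j - A i := by
    intro d
    induction d with
    | zero =>
      intro j hj
      have : j = i := Fin.ext (by omega)
      simp [this]
    | succ d ih =>
      intro j hj
      have hlt : (i : ℕ) + d < c := by omega
      have h1 := ih ⟨i + d, hlt⟩ rfl
      have h2 : A ⟨i + d, hlt⟩ < A j := hA (by rw [Fin.lt_def]; simp only; omega)
      push_cast
      omega
  have hij' : (i : ℕ) ≤ j := hij
  have := key (j - i) j (by omega)
  omega

lemma IsRouting.gap {u : Fin c → Fin (a + b + 1) → ℤ} (hu : IsRouting u) {i j : Fin c}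
    (hij : i ≤ j) (x : Fin (a + b + 1)) : ((j : ℕ) : ℤ) - ((i : ℕ) : ℤ) ≤ u j x - u i x :=
  le_sub_of_strictMono (A := fun i => u i x) (fun i j h => hu.disjoint i j h x) hij

variable (u v : Routing a b c) (i j : Fin c) (x : Fin (a + b + 1))

lemma mem_tower_up : j ∈ tower u i x true ↔
    i ≤ j ∧ u.1 j x - u.1 i x = ((j : ℕ) : ℤ) - ((i : ℕ) : ℤ) := by
  simp [tower]

lemma mem_tower_down : j ∈ tower u i x false ↔
    j ≤ i ∧ u.1 j x - u.1 i x = ((j : ℕ) : ℤ) - ((i : ℕ) : ℤ) := by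
  simp [tower]

lemma self_mem_tower (up : Bool) : i ∈ tower u i x up := by
  simp [tower]

lemma tower_card_pos (up : Bool) : 0 < (tower u i x up).card :=
  card_pos.2 ⟨i, self_mem_tower u i x up⟩

variable {u v i j x}

lemma pushed_of_ne {up : Bool} {y : Fin (a + b + 1)} (h : y ≠ x) :
    pushed u i x up j y = u.1 j y := by
  simp [pushed, h]

lemma pushed_of_mem {up : Bool} (h : j ∈ tower u i x up) :
    pushed u i x up j x = u.1 j x + (if up then 1 else -1) := by
  simp [pushed, h]

lemma pushed_of_notMem {up : Bool} {y : Fin (a + b + 1)} (h : j ∉ tower u i x up) :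
    pushed u i x up j y = u.1 j y := by
  simp [pushed, h]

variable {y z : Fin (a + b)}

/-- Only path `i` has to be tested for a valley at `x`. A path `j` at the minimal distance `j - i`
above it in column `x` is squeezed by the gap inequality in both neighbouring columns, so it has a
valley too. The first path above the tower is not at minimal distance, so there is room to move. -/
lemma isRouting_pushed_up_iff (hy : y.succ = x) (hz : z.castSucc = x) :
    IsRouting (pushed u i x true) ↔
      u.1 i y.castSucc = u.1 i x ∧ u.1 i z.succ = u.1 i x + 1 := by
  have hyx : y.castSucc ≠ x := by rw [← hy]; exact (Fin.castSucc_lt_succ).ne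
  have hzx : z.succ ≠ x := by rw [← hz]; exact (Fin.castSucc_lt_succ).ne'
  have hx0 : (0 : Fin (a + b + 1)) ≠ x := by rw [← hy]; exact (Fin.succ_ne_zero y).symm
  have hxl : Fin.last (a + b) ≠ x := by rw [← hz]; exact (Fin.castSucc_lt_last z).ne'
  constructor
  · intro h
    have h1 := h.step i y
    have h2 := h.step i z
    have h3 := u.2.step i y
    have h4 := u.2.step i z
    rw [hy] at h1 h3
    rw [hz] at h2 h4
    rw [pushed_of_mem (self_mem_tower u i x true), pushed_of_ne hyx] at h1
    rw [pushed_of_mem (self_mem_tower u i x true), pushed_of_ne hzx] at h2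
    simp only [if_true] at h1 h2
    omega
  · rintro ⟨h1, h2⟩
    refine ⟨fun j => ?_, fun j => ?_, fun j w => ?_, fun j l hjl w => ?_⟩
    · rw [pushed_of_ne hx0, u.2.start]
    · rw [pushed_of_ne hxl, u.2.finish]
    · by_cases hj : j ∈ tower u i x true
      · by_cases hw : w.succ = x
        · have hwy : w = y := Fin.succ_injective _ (hw.trans hy.symm)
          subst hwy
          rw [hw, pushed_of_mem hj, pushed_of_ne hyx]
          have h3 := u.2.step j w
          rw [hw] at h3
          rw [mem_tower_up] at hj
          have h4 := u.2.gap hj.1 w.castSucc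
          simp only [if_true]
          omega
        · by_cases hw' : w.castSucc = x
          · have hwz : w = z := Fin.castSucc_injective _ (hw'.trans hz.symm)
            subst hwz
            rw [hw', pushed_of_mem hj, pushed_of_ne hzx]
            have h3 := u.2.step j w
            rw [hw'] at h3
            rw [mem_tower_up] at hj
            have h4 := u.2.gap hj.1 w.succ
            simp only [if_true]
            omega
          · rw [pushed_of_ne hw, pushed_of_ne hw']
            exact u.2.step j w
      · rw [pushed_of_notMem hj, pushed_of_notMem hj]
        exact u.2.step j w
    · have h0 := u.2.disjoint j l hjl w
      by_cases hw : w = x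
      · subst hw
        by_cases hl : l ∈ tower u i w true
        · rw [pushed_of_mem hl]
          by_cases hj : j ∈ tower u i w true
          · rw [pushed_of_mem hj]; omega
          · rw [pushed_of_notMem hj]; simp only [if_true]; omega
        · rw [pushed_of_notMem hl]
          by_cases hj : j ∈ tower u i w true
          · rw [pushed_of_mem hj]
            rw [mem_tower_up] at hl hj
            have h3 := u.2.gap hjl.le w
            have h4 : (j : ℕ) < l := hjl
            have h5 : i ≤ l := hj.1.trans hjl.le
            have h6 : ¬ (u.1 l w - u.1 i w = ((l : ℕ) : ℤ) - ((i : ℕ) : ℤ)) := fun h => hl ⟨h5, h⟩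
            simp only [if_true]
            omega
          · rw [pushed_of_notMem hj]; exact h0
      · rw [pushed_of_ne hw, pushed_of_ne hw]; exact h0

lemma isRouting_pushed_down_iff (hy : y.succ = x) (hz : z.castSucc = x) :
    IsRouting (pushed u i x false) ↔
      u.1 i y.castSucc + 1 = u.1 i x ∧ u.1 i z.succ = u.1 i x := by
  have hyx : y.castSucc ≠ x := by rw [← hy]; exact (Fin.castSucc_lt_succ).ne
  have hzx : z.succ ≠ x := by rw [← hz]; exact (Fin.castSucc_lt_succ).ne'
  have hx0 : (0 : Fin (a + b + 1)) ≠ x := by rw [← hy]; exact (Fin.succ_ne_zero y).symm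
  have hxl : Fin.last (a + b) ≠ x := by rw [← hz]; exact (Fin.castSucc_lt_last z).ne'
  constructor
  · intro h
    have h1 := h.step i y
    have h2 := h.step i z
    have h3 := u.2.step i y
    have h4 := u.2.step i z
    rw [hy] at h1 h3
    rw [hz] at h2 h4
    rw [pushed_of_mem (self_mem_tower u i x false), pushed_of_ne hyx] at h1
    rw [pushed_of_mem (self_mem_tower u i x false), pushed_of_ne hzx] at h2
    simp only [Bool.false_eq_true, if_false] at h1 h2
    omega
  · rintro ⟨h1, h2⟩
    refine ⟨fun j => ?_, fun j => ?_, fun j w => ?_, fun j l hjl w => ?_⟩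
    · rw [pushed_of_ne hx0, u.2.start]
    · rw [pushed_of_ne hxl, u.2.finish]
    · by_cases hj : j ∈ tower u i x false
      · by_cases hw : w.succ = x
        · have hwy : w = y := Fin.succ_injective _ (hw.trans hy.symm)
          subst hwy
          rw [hw, pushed_of_mem hj, pushed_of_ne hyx]
          have h3 := u.2.step j w
          rw [hw] at h3
          rw [mem_tower_down] at hj
          have h4 := u.2.gap hj.1 w.castSucc
          simp only [Bool.false_eq_true, if_false]
          omega
        · by_cases hw' : w.castSucc = x
          · have hwz : w = z := Fin.castSucc_injective _ (hw'.trans hz.symm)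
            subst hwz
            rw [hw', pushed_of_mem hj, pushed_of_ne hzx]
            have h3 := u.2.step j w
            rw [hw'] at h3
            rw [mem_tower_down] at hj
            have h4 := u.2.gap hj.1 w.succ
            simp only [Bool.false_eq_true, if_false]
            omega
          · rw [pushed_of_ne hw, pushed_of_ne hw']
            exact u.2.step j w
      · rw [pushed_of_notMem hj, pushed_of_notMem hj]
        exact u.2.step j w
    · have h0 := u.2.disjoint j l hjl w
      by_cases hw : w = x
      · subst hw
        by_cases hj : j ∈ tower u i w false
        · rw [pushed_of_mem hj]
          by_cases hl : l ∈ tower u i w false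
          · rw [pushed_of_mem hl]; omega
          · rw [pushed_of_notMem hl]; simp only [Bool.false_eq_true, if_false]; omega
        · rw [pushed_of_notMem hj]
          by_cases hl : l ∈ tower u i w false
          · rw [pushed_of_mem hl]
            rw [mem_tower_down] at hl hj
            have h3 := u.2.gap hjl.le w
            have h4 : (j : ℕ) < l := hjl
            have h5 : j ≤ i := hjl.le.trans hl.1
            have h6 : ¬ (u.1 j w - u.1 i w = ((j : ℕ) : ℤ) - ((i : ℕ) : ℤ)) := fun h => hj ⟨h5, h⟩
            simp only [Bool.false_eq_true, if_false]
            omega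
          · rw [pushed_of_notMem hl]; exact h0
      · rw [pushed_of_ne hw, pushed_of_ne hw]; exact h0

/-- The operator on functions given by one attempted push. -/
def pushOp (i : Fin c) (x : Fin (a + b + 1)) (up : Bool) (f : Routing a b c → ℝ)
    (u : Routing a b c) : ℝ :=
  ∑ v, pushProb u i x up v * f v

lemma pushOp_of_isRouting {up : Bool} (h : IsRouting (pushed u i x up)) (f : Routing a b c → ℝ) :
    pushOp i x up f u = 1 / ((tower u i x up).card : ℝ) * f ⟨pushed u i x up, h⟩ +
      (1 - 1 / ((tower u i x up).card : ℝ)) * f u := by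
  classical
  have h1 : ∀ v : Routing a b c, pushProb u i x up v * f v =
      (if v = ⟨pushed u i x up, h⟩ then 1 / ((tower u i x up).card : ℝ) * f v else 0) +
      (if v = u then (1 - 1 / ((tower u i x up).card : ℝ)) * f v else 0) := by
    intro v
    simp only [pushProb, if_pos h, Subtype.ext_iff]
    split_ifs <;> ring
  simp only [pushOp, h1, sum_add_distrib, sum_ite_eq', mem_univ, if_true]

lemma pushOp_of_not_isRouting {up : Bool} (h : ¬ IsRouting (pushed u i x up))
    (f : Routing a b c → ℝ) : pushOp i x up f u = f u := by
  classical
  simp [pushOp, pushProb, if_neg h]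

lemma inv_card_tower_mem (up : Bool) :
    0 < 1 / ((tower u i x up).card : ℝ) ∧ 1 / ((tower u i x up).card : ℝ) ≤ 1 := by
  have h : (1 : ℝ) ≤ (tower u i x up).card := by
    exact_mod_cast tower_card_pos u i x up
  exact ⟨by positivity, by rw [div_le_one (by linarith)]; exact h⟩

lemma le_pushed_up (h : IsRouting (pushed u i x true)) : u ≤ ⟨pushed u i x true, h⟩ := by
  intro j w
  change u.1 j w ≤ pushed u i x true j w
  simp only [pushed]
  split_ifs <;> omega

lemma pushed_down_le (h : IsRouting (pushed u i x false)) : ⟨pushed u i x false, h⟩ ≤ u := by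
  intro j w
  change pushed u i x false j w ≤ u.1 j w
  simp only [pushed, Bool.false_eq_true, if_false]
  split_ifs <;> omega

lemma le_pushOp_up {f : Routing a b c → ℝ} (hf : Monotone f) : f u ≤ pushOp i x true f u := by
  by_cases h : IsRouting (pushed u i x true)
  · rw [pushOp_of_isRouting h]
    have h1 := hf (le_pushed_up h)
    have h2 := (inv_card_tower_mem (u := u) (i := i) (x := x) true).1
    nlinarith
  · rw [pushOp_of_not_isRouting h]

lemma pushOp_down_le {f : Routing a b c → ℝ} (hf : Monotone f) : pushOp i x false f u ≤ f u := by
  by_cases h : IsRouting (pushed u i x false)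
  · rw [pushOp_of_isRouting h]
    have h1 := hf (pushed_down_le h)
    have h2 := (inv_card_tower_mem (u := u) (i := i) (x := x) false).1
    nlinarith
  · rw [pushOp_of_not_isRouting h]

lemma exists_neighbours (h0 : x ≠ 0) (hl : x ≠ Fin.last (a + b)) :
    ∃ y z : Fin (a + b), y.succ = x ∧ z.castSucc = x := by
  obtain ⟨y, hy⟩ := Fin.exists_succ_eq.2 h0
  obtain ⟨z, hz⟩ := Fin.exists_castSucc_eq.2 hl
  exact ⟨y, z, hy, hz⟩

/-- If `u ≤ v` agree at the chosen point, a valley of `u` is also one of `v`, and the tower of `v`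
is contained in that of `u`, so `v` moves at least as often; the two moves can be coupled. If `u` is
strictly lower there, its whole tower still fits under `v` after the push. -/
lemma pushOp_up_mono (h0 : x ≠ 0) (hl : x ≠ Fin.last (a + b)) {f : Routing a b c → ℝ}
    (hf : Monotone f) : Monotone (pushOp i x true f) := by
  obtain ⟨y, z, hy, hz⟩ := exists_neighbours h0 hl
  intro u v huv
  have huv' : ∀ j w, u.1 j w ≤ v.1 j w := huv
  by_cases hu : IsRouting (pushed u i x true)
  · by_cases hi : u.1 i x = v.1 i x
    · have hu' := (isRouting_pushed_up_iff hy hz).1 hu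
      have hv : IsRouting (pushed v i x true) := by
        rw [isRouting_pushed_up_iff hy hz]
        have h1 := v.2.step i y
        have h2 := v.2.step i z
        rw [hy] at h1
        rw [hz] at h2
        have h3 := huv' i y.castSucc
        have h4 := huv' i z.succ
        omega
      have hsub : tower v i x true ⊆ tower u i x true := by
        intro j hj
        rw [mem_tower_up] at hj ⊢
        have h1 := u.2.gap hj.1 x
        have h2 := huv' j x
        exact ⟨hj.1, by omega⟩
      have hle : (⟨pushed u i x true, hu⟩ : Routing a b c) ≤ ⟨pushed v i x true, hv⟩ := by
        intro j w
        change pushed u i x true j w ≤ pushed v i x true j w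
        have h2 := huv' j w
        by_cases hw : w = x
        · subst hw
          by_cases hj : j ∈ tower u i w true
          · rw [pushed_of_mem hj]
            by_cases hj' : j ∈ tower v i w true
            · rw [pushed_of_mem hj']; omega
            · rw [pushed_of_notMem hj']
              rw [mem_tower_up] at hj hj'
              have h3 : ¬ (v.1 j w - v.1 i w = ((j : ℕ) : ℤ) - ((i : ℕ) : ℤ)) :=
                fun h => hj' ⟨hj.1, h⟩
              simp only [if_true]
              omega
          · rw [pushed_of_notMem hj]
            exact h2.trans (le_pushed_up hv j w)
        · rw [pushed_of_ne hw, pushed_of_ne hw]; exact h2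
      rw [pushOp_of_isRouting hu, pushOp_of_isRouting hv]
      have e1 := hf hle
      have e2 := hf huv
      have e3 := hf (le_pushed_up hv)
      have e4 : 1 / ((tower u i x true).card : ℝ) ≤ 1 / ((tower v i x true).card : ℝ) := by
        apply one_div_le_one_div_of_le
        · exact_mod_cast tower_card_pos v i x true
        · exact_mod_cast card_le_card hsub
      obtain ⟨e5, e6⟩ := inv_card_tower_mem (u := u) (i := i) (x := x) true
      set p := 1 / ((tower u i x true).card : ℝ)
      set q := 1 / ((tower v i x true).card : ℝ)
      -- With primes for pushed states, the difference of the two sides is `p (f v' - f u') + (1 -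
      -- p) (f v - f u) + (q - p) (f v' - f v)`: both move, neither is forced to move, only `v`
      -- moves.
      nlinarith [mul_nonneg e5.le (sub_nonneg.2 e1), mul_nonneg (sub_nonneg.2 e6) (sub_nonneg.2 e2),
        mul_nonneg (sub_nonneg.2 e4) (sub_nonneg.2 e3)]
    · have hle : (⟨pushed u i x true, hu⟩ : Routing a b c) ≤ v := by
        intro j w
        change pushed u i x true j w ≤ v.1 j w
        have h2 := huv' j w
        by_cases hw : w = x
        · subst hw
          by_cases hj : j ∈ tower u i w true
          · rw [pushed_of_mem hj]
            rw [mem_tower_up] at hj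
            have h3 := v.2.gap hj.1 w
            have h4 := huv' i w
            simp only [if_true]
            omega
          · rw [pushed_of_notMem hj]; exact h2
        · rw [pushed_of_ne hw]; exact h2
      refine le_trans ?_ (le_pushOp_up hf)
      rw [pushOp_of_isRouting hu]
      have e1 := hf hle
      have e2 := hf huv
      obtain ⟨e5, e6⟩ := inv_card_tower_mem (u := u) (i := i) (x := x) true
      set p := 1 / ((tower u i x true).card : ℝ)
      nlinarith [mul_nonneg e5.le (sub_nonneg.2 e1), mul_nonneg (sub_nonneg.2 e6) (sub_nonneg.2 e2)]
  · rw [pushOp_of_not_isRouting hu]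
    exact (hf huv).trans (le_pushOp_up hf)

lemma pushOp_down_mono (h0 : x ≠ 0) (hl : x ≠ Fin.last (a + b)) {f : Routing a b c → ℝ}
    (hf : Monotone f) : Monotone (pushOp i x false f) := by
  obtain ⟨y, z, hy, hz⟩ := exists_neighbours h0 hl
  -- The names are exchanged: `u`, the state supposed to move, is now the larger one.
  intro v u huv
  have huv' : ∀ j w, v.1 j w ≤ u.1 j w := huv
  by_cases hu : IsRouting (pushed u i x false)
  · by_cases hi : u.1 i x = v.1 i x
    · have hu' := (isRouting_pushed_down_iff hy hz).1 hu
      have hv : IsRouting (pushed v i x false) := by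
        rw [isRouting_pushed_down_iff hy hz]
        have h1 := v.2.step i y
        have h2 := v.2.step i z
        rw [hy] at h1
        rw [hz] at h2
        have h3 := huv' i y.castSucc
        have h4 := huv' i z.succ
        omega
      have hsub : tower v i x false ⊆ tower u i x false := by
        intro j hj
        rw [mem_tower_down] at hj ⊢
        have h1 := u.2.gap hj.1 x
        have h2 := huv' j x
        exact ⟨hj.1, by omega⟩
      have hle : (⟨pushed v i x false, hv⟩ : Routing a b c) ≤ ⟨pushed u i x false, hu⟩ := by
        intro j w
        change pushed v i x false j w ≤ pushed u i x false j w
        have h2 := huv' j w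
        by_cases hw : w = x
        · subst hw
          by_cases hj : j ∈ tower u i w false
          · rw [pushed_of_mem hj]
            by_cases hj' : j ∈ tower v i w false
            · rw [pushed_of_mem hj']; omega
            · rw [pushed_of_notMem hj']
              rw [mem_tower_down] at hj hj'
              have h3 : ¬ (v.1 j w - v.1 i w = ((j : ℕ) : ℤ) - ((i : ℕ) : ℤ)) :=
                fun h => hj' ⟨hj.1, h⟩
              simp only [Bool.false_eq_true, if_false]
              omega
          · rw [pushed_of_notMem hj]
            exact (pushed_down_le hv j w).trans h2
        · rw [pushed_of_ne hw, pushed_of_ne hw]; exact h2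
      rw [pushOp_of_isRouting hu, pushOp_of_isRouting hv]
      have e1 := hf hle
      have e2 := hf huv
      have e3 := hf (pushed_down_le hv)
      have e4 : 1 / ((tower u i x false).card : ℝ) ≤ 1 / ((tower v i x false).card : ℝ) := by
        apply one_div_le_one_div_of_le
        · exact_mod_cast tower_card_pos v i x false
        · exact_mod_cast card_le_card hsub
      obtain ⟨e5, e6⟩ := inv_card_tower_mem (u := u) (i := i) (x := x) false
      set p := 1 / ((tower u i x false).card : ℝ)
      set q := 1 / ((tower v i x false).card : ℝ)
      nlinarith [mul_nonneg e5.le (sub_nonneg.2 e1), mul_nonneg (sub_nonneg.2 e6) (sub_nonneg.2 e2),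
        mul_nonneg (sub_nonneg.2 e4) (sub_nonneg.2 e3)]
    · have hle : v ≤ (⟨pushed u i x false, hu⟩ : Routing a b c) := by
        intro j w
        change v.1 j w ≤ pushed u i x false j w
        have h2 := huv' j w
        by_cases hw : w = x
        · subst hw
          by_cases hj : j ∈ tower u i w false
          · rw [pushed_of_mem hj]
            rw [mem_tower_down] at hj
            have h3 := v.2.gap hj.1 w
            have h4 := huv' i w
            simp only [Bool.false_eq_true, if_false]
            omega
          · rw [pushed_of_notMem hj]; exact h2
        · rw [pushed_of_ne hw]; exact h2
      refine (pushOp_down_le hf).trans ?_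
      rw [pushOp_of_isRouting hu]
      have e1 := hf hle
      have e2 := hf huv
      obtain ⟨e5, e6⟩ := inv_card_tower_mem (u := u) (i := i) (x := x) false
      set p := 1 / ((tower u i x false).card : ℝ)
      nlinarith [mul_nonneg e5.le (sub_nonneg.2 e1), mul_nonneg (sub_nonneg.2 e6) (sub_nonneg.2 e2)]
  · rw [pushOp_of_not_isRouting hu]
    exact (pushOp_down_le hf).trans (hf huv)

end Push

/-! ### The column operators -/

section Column

variable {a b c : ℕ} {u v : Routing a b c} {i j : Fin c} {x : Fin (a + b + 1)}

lemma tower_eq_of_eq_pushed {up : Bool} (h : v.1 = pushed u i x up) :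
    tower u i x up = univ.filter fun j => v.1 j x ≠ u.1 j x := by
  ext j
  rw [mem_filter, h]
  by_cases hj : j ∈ tower u i x up
  · rw [pushed_of_mem hj]
    cases up <;> simp [hj]
  · rw [pushed_of_notMem hj]
    simp [hj]

/-- The tower can be read off as the set of paths whose point has moved, and `i` is its lowest
member. -/
lemma pushed_up_unique (hi : v.1 = pushed u i x true) (hj : v.1 = pushed u j x true) : i = j := by
  have h := (tower_eq_of_eq_pushed hi).trans (tower_eq_of_eq_pushed hj).symm
  have h1 : i ∈ tower u j x true := h ▸ self_mem_tower u i x true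
  have h2 : j ∈ tower u i x true := h ▸ self_mem_tower u j x true
  exact le_antisymm ((mem_tower_up u i j x).1 h2).1 ((mem_tower_up u j i x).1 h1).1

lemma pushed_down_unique (hi : v.1 = pushed u i x false) (hj : v.1 = pushed u j x false) :
    i = j := by
  have h := (tower_eq_of_eq_pushed hi).trans (tower_eq_of_eq_pushed hj).symm
  have h1 : i ∈ tower u j x false := h ▸ self_mem_tower u i x false
  have h2 : j ∈ tower u i x false := h ▸ self_mem_tower u j x false
  exact le_antisymm ((mem_tower_down u j i x).1 h1).1 ((mem_tower_down u i j x).1 h2).1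

/-- A push up by the lowest path of a tower is undone by a push down by the highest path of the same
tower. The tower size, and with it the probability, agrees, but the pushing path changes. -/
lemma exists_pushed_down_of_pushed_up (h : v.1 = pushed u i x true) :
    ∃ j, u.1 = pushed v j x false ∧ tower v j x false = tower u i x true := by
  have hne : (tower u i x true).Nonempty := ⟨i, self_mem_tower u i x true⟩
  set j := (tower u i x true).max' hne with hjdef
  have hj : j ∈ tower u i x true := max'_mem _ hne
  have hval : ∀ l ∈ tower u i x true, v.1 l x = u.1 l x + 1 := fun l hl => by
    rw [h, pushed_of_mem hl]; rfl
  have hval' : ∀ l ∉ tower u i x true, v.1 l x = u.1 l x := fun l hl => by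
    rw [h, pushed_of_notMem hl]
  have htow : tower v j x false = tower u i x true := by
    ext l
    rw [mem_tower_down, hval j hj]
    have hj' := (mem_tower_up u i j x).1 hj
    constructor
    · rintro ⟨h1, h2⟩
      by_contra hl
      rw [hval' l hl] at h2
      rcases le_total i l with hil | hil
      · have g1 := u.2.gap hil x
        have g2 := u.2.gap h1 x
        exact hl ((mem_tower_up u i l x).2 ⟨hil, by omega⟩)
      · have g1 := u.2.gap hil x
        omega
    · intro hl
      rw [hval l hl]
      have hl' := (mem_tower_up u i l x).1 hl
      exact ⟨le_max' _ _ hl, by omega⟩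
  refine ⟨j, ?_, htow⟩
  funext l y
  by_cases hy : y = x
  · subst hy
    by_cases hl : l ∈ tower u i y true
    · rw [pushed_of_mem (htow ▸ hl), hval l hl]
      simp
    · rw [pushed_of_notMem (htow ▸ hl), hval' l hl]
  · rw [pushed_of_ne hy, h, pushed_of_ne hy]

lemma exists_pushed_up_of_pushed_down (h : v.1 = pushed u i x false) :
    ∃ j, u.1 = pushed v j x true ∧ tower v j x true = tower u i x false := by
  have hne : (tower u i x false).Nonempty := ⟨i, self_mem_tower u i x false⟩
  set j := (tower u i x false).min' hne with hjdef
  have hj : j ∈ tower u i x false := min'_mem _ hne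
  have hval : ∀ l ∈ tower u i x false, v.1 l x = u.1 l x - 1 := fun l hl => by
    rw [h, pushed_of_mem hl]; rfl
  have hval' : ∀ l ∉ tower u i x false, v.1 l x = u.1 l x := fun l hl => by
    rw [h, pushed_of_notMem hl]
  have htow : tower v j x true = tower u i x false := by
    ext l
    rw [mem_tower_up, hval j hj]
    have hj' := (mem_tower_down u i j x).1 hj
    constructor
    · rintro ⟨h1, h2⟩
      by_contra hl
      rw [hval' l hl] at h2
      rcases le_total i l with hil | hil
      · have g1 := u.2.gap hil x
        omega
      · have g1 := u.2.gap hil x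
        have g2 := u.2.gap h1 x
        exact hl ((mem_tower_down u i l x).2 ⟨hil, by omega⟩)
    · intro hl
      rw [hval l hl]
      have hl' := (mem_tower_down u i l x).1 hl
      exact ⟨min'_le _ _ hl, by omega⟩
  refine ⟨j, ?_, htow⟩
  funext l y
  by_cases hy : y = x
  · subst hy
    by_cases hl : l ∈ tower u i y false
    · rw [pushed_of_mem (htow ▸ hl), hval l hl]
      simp
    · rw [pushed_of_notMem (htow ▸ hl), hval' l hl]
  · rw [pushed_of_ne hy, h, pushed_of_ne hy]

lemma pushProb_of_eq_pushed {up : Bool} (huv : v ≠ u) (h : v.1 = pushed u i x up) :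
    pushProb u i x up v = 1 / ((tower u i x up).card : ℝ) := by
  have hr : IsRouting (pushed u i x up) := h ▸ v.2
  simp [pushProb, hr, huv, h]

lemma pushProb_of_ne_pushed {up : Bool} (huv : v ≠ u) (h : v.1 ≠ pushed u i x up) :
    pushProb u i x up v = 0 := by
  simp [pushProb, huv, h]

/-- Since the reverse move belongs to another path, detailed balance holds only after summing over
the paths of a column. At most one term of each sum is nonzero. -/
lemma sum_pushProb_up_eq_down (huv : v ≠ u) (x : Fin (a + b + 1)) :
    ∑ i, pushProb u i x true v = ∑ i, pushProb v i x false u := by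
  by_cases hex : ∃ i, v.1 = pushed u i x true
  · obtain ⟨i, hi⟩ := hex
    obtain ⟨j, hj, ht⟩ := exists_pushed_down_of_pushed_up hi
    rw [Fintype.sum_eq_single i, Fintype.sum_eq_single j, pushProb_of_eq_pushed huv hi,
      pushProb_of_eq_pushed huv.symm hj, ht]
    · exact fun l hl => pushProb_of_ne_pushed huv.symm fun h => hl (pushed_down_unique h hj)
    · exact fun l hl => pushProb_of_ne_pushed huv fun h => hl (pushed_up_unique h hi)
  · rw [sum_eq_zero, sum_eq_zero]
    · intro j _
      refine pushProb_of_ne_pushed huv.symm fun h => hex ?_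
      obtain ⟨i, hi, -⟩ := exists_pushed_up_of_pushed_down h
      exact ⟨i, hi⟩
    · exact fun i _ => pushProb_of_ne_pushed huv fun h => hex ⟨i, h⟩

/-- The sum of all pushing operators in one column. -/
def colOp (x : Fin (a + b + 1)) (f : Routing a b c → ℝ) (u : Routing a b c) : ℝ :=
  ∑ i, (pushOp i x true f u + pushOp i x false f u)

/-- The kernel of `colOp`. -/
def colKernel (x : Fin (a + b + 1)) (u v : Routing a b c) : ℝ :=
  ∑ i, (pushProb u i x true v + pushProb u i x false v)

lemma colKernel_comm (x : Fin (a + b + 1)) (u v : Routing a b c) :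
    colKernel x u v = colKernel x v u := by
  by_cases huv : v = u
  · rw [huv]
  · simp only [colKernel, sum_add_distrib]
    rw [sum_pushProb_up_eq_down huv, sum_pushProb_up_eq_down (u := v) (v := u) (Ne.symm huv),
      add_comm]

lemma colOp_eq_sum (x : Fin (a + b + 1)) (f : Routing a b c → ℝ) (u : Routing a b c) :
    colOp x f u = ∑ v, colKernel x u v * f v := by
  simp only [colOp, colKernel, pushOp, sum_mul, add_mul, ← sum_add_distrib]
  rw [sum_comm]

lemma sum_mul_colOp (x : Fin (a + b + 1)) (f g : Routing a b c → ℝ) :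
    ∑ u, f u * colOp x g u = ∑ u, colOp x f u * g u := by
  simp only [colOp_eq_sum, mul_sum, sum_mul]
  rw [sum_comm]
  refine sum_congr rfl fun u _ => sum_congr rfl fun v _ => ?_
  rw [colKernel_comm]
  ring

lemma pushOp_of_forall_eq {up : Bool} {f : Routing a b c → ℝ}
    (hf : ∀ v : Routing a b c, (∀ j y, y ≠ x → v.1 j y = u.1 j y) → f v = f u) :
    pushOp i x up f u = f u := by
  by_cases h : IsRouting (pushed u i x up)
  · rw [pushOp_of_isRouting h, hf ⟨_, h⟩ fun j y hy => pushed_of_ne hy]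
    ring
  · rw [pushOp_of_not_isRouting h]

lemma colOp_of_forall_eq {f : Routing a b c → ℝ}
    (hf : ∀ v : Routing a b c, (∀ j y, y ≠ x → v.1 j y = u.1 j y) → f v = f u) :
    colOp x f u = 2 * c * f u := by
  simp only [colOp, pushOp_of_forall_eq hf, sum_const, card_univ, Fintype.card_fin, nsmul_eq_mul]
  ring

lemma columnHeight_congr {y : Fin (a + b + 1)} (h : ∀ j, v.1 j y = u.1 j y) :
    columnHeight y v = columnHeight y u := by
  simp [columnHeight, height, h]

lemma columnHeight_pushed {up : Bool} (h : IsRouting (pushed u i x up)) :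
    columnHeight x (⟨pushed u i x up, h⟩ : Routing a b c) =
      columnHeight x u + (if up then 1 else -1) * ((tower u i x up).card : ℝ) := by
  simp only [columnHeight, height]
  rw [← sub_eq_iff_eq_add', ← sum_sub_distrib, mul_comm, ← nsmul_eq_mul, ← sum_const,
    ← sum_subset (subset_univ (tower u i x up))]
  · refine sum_congr rfl fun j hj => ?_
    rw [pushed_of_mem hj]
    cases up <;> simp
  · intro j _ hj
    rw [pushed_of_notMem hj]
    ring

/-- The tower size cancels against the acceptance probability. This is what makes the action on
column heights linear. -/
lemma pushOp_columnHeight {up : Bool} (h : IsRouting (pushed u i x up)) :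
    pushOp i x up (columnHeight x) u = columnHeight x u + (if up then 1 else -1) := by
  rw [pushOp_of_isRouting h, columnHeight_pushed h]
  have : ((tower u i x up).card : ℝ) ≠ 0 := by
    exact_mod_cast (tower_card_pos u i x up).ne'
  field_simp
  ring

lemma colOp_columnHeight {y z : Fin (a + b)} (hy : y.succ = x) (hz : z.castSucc = x) :
    colOp x (columnHeight x) u = 2 * c * columnHeight x u +
      (columnHeight y.castSucc u + columnHeight z.succ u - 2 * columnHeight x u) := by
  -- The second difference of path `i` at `x` is `1` at a valley, `-1` at a peak and `0` otherwise,
  -- which matches the expected change. The correction `x / 2` in `height` is linear in `x` and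
  -- drops out.
  have key : ∀ i, pushOp i x true (columnHeight x) u + pushOp i x false (columnHeight x) u =
      2 * columnHeight x u +
        (height u i y.castSucc + height u i z.succ - 2 * height u i x) := by
    intro i
    have hyx : (x : ℕ) = y + 1 := by rw [← hy]; rfl
    have hzx : (z : ℕ) = x := by rw [← hz]; rfl
    have hh : height u i y.castSucc + height u i z.succ - 2 * height u i x =
        ((u.1 i y.castSucc + u.1 i z.succ - 2 * u.1 i x : ℤ) : ℝ) := by
      simp only [height, Fin.val_castSucc, Fin.val_succ, hzx, hyx]
      push_cast
      ring
    have s1 := u.2.step i y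
    have s2 := u.2.step i z
    rw [hy] at s1
    rw [hz] at s2
    by_cases h1 : IsRouting (pushed u i x true)
    · have h1' := (isRouting_pushed_up_iff hy hz).1 h1
      have h2 : ¬ IsRouting (pushed u i x false) := by
        rw [isRouting_pushed_down_iff hy hz]; omega
      rw [pushOp_columnHeight h1, pushOp_of_not_isRouting h2, hh,
        show u.1 i y.castSucc + u.1 i z.succ - 2 * u.1 i x = 1 by omega]
      simp only [if_true]
      push_cast
      ring
    · rw [pushOp_of_not_isRouting h1]
      have h1' := h1
      rw [isRouting_pushed_up_iff hy hz] at h1'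
      by_cases h2 : IsRouting (pushed u i x false)
      · have h2' := (isRouting_pushed_down_iff hy hz).1 h2
        rw [pushOp_columnHeight h2, hh,
          show u.1 i y.castSucc + u.1 i z.succ - 2 * u.1 i x = -1 by omega]
        simp only [Bool.false_eq_true, if_false]
        push_cast
        ring
      · rw [pushOp_of_not_isRouting h2]
        rw [isRouting_pushed_down_iff hy hz] at h2
        rw [hh, show u.1 i y.castSucc + u.1 i z.succ - 2 * u.1 i x = 0 by omega]
        push_cast
        ring
  simp only [colOp, key, sum_add_distrib, sum_sub_distrib, ← mul_sum, sum_const, card_univ,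
    Fintype.card_fin, nsmul_eq_mul, columnHeight]
  ring

/-- The columns of the internal points. -/
def internalColumns (a b : ℕ) : Finset (Fin (a + b + 1)) :=
  univ.filter fun x => x ≠ 0 ∧ x ≠ Fin.last (a + b)

lemma sum_sites {M : Type*} [AddCommMonoid M] (F : Fin c × Fin (a + b + 1) → M) :
    ∑ s ∈ sites a b c, F s = ∑ x ∈ internalColumns a b, ∑ i, F (i, x) := by
  have : sites a b c = univ ×ˢ internalColumns a b := by
    ext ⟨i, x⟩
    simp [sites, internalColumns]
  rw [this, sum_product_right]

lemma transition_apply (u v : Routing a b c) :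
    transition a b c u v =
      1 / (2 * ((sites a b c).card : ℝ)) * ∑ x ∈ internalColumns a b, colKernel x u v := by
  simp only [transition, Matrix.of_apply, sum_sites, colKernel, mul_sum, Fintype.sum_bool]
  refine sum_congr rfl fun x _ => sum_congr rfl fun i _ => ?_
  rw [← mul_add]
  congr 1
  rw [one_div_mul_one_div]
  ring

lemma transition_isSymm : (transition a b c).IsSymm := by
  ext u v
  rw [Matrix.transpose_apply, transition_apply, transition_apply]
  simp only [colKernel_comm _ v u]

lemma transition_mulVec (f : Routing a b c → ℝ) (u : Routing a b c) :
    (transition a b c).mulVec f u =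
      1 / (2 * ((sites a b c).card : ℝ)) * ∑ x ∈ internalColumns a b, colOp x f u := by
  simp only [Matrix.mulVec, dotProduct, transition_apply, colOp_eq_sum]
  simp only [mul_assoc, ← mul_sum, sum_mul]
  rw [sum_comm]

lemma card_sites : ((sites a b c).card : ℝ) = (internalColumns a b).card * c := by
  have : sites a b c = univ ×ˢ internalColumns a b := by
    ext ⟨i, x⟩
    simp [sites, internalColumns]
  rw [this, card_product]
  simp [mul_comm]

lemma card_sites_pos (ha : 1 ≤ a) (hb : 1 ≤ b) (hc : 1 ≤ c) : 0 < ((sites a b c).card : ℝ) := by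
  have h : (⟨⟨0, hc⟩, ⟨1, by omega⟩⟩ : Fin c × Fin (a + b + 1)) ∈ sites a b c := by
    simp only [sites, mem_filter, mem_univ, true_and, Fin.ext_iff, ne_eq, Fin.val_zero,
      Fin.val_last]
    omega
  exact_mod_cast card_pos.2 ⟨_, h⟩

lemma transition_mulVec_mono {f : Routing a b c → ℝ} (hf : Monotone f) :
    Monotone ((transition a b c).mulVec f) := by
  intro u v huv
  rw [transition_mulVec, transition_mulVec]
  refine mul_le_mul_of_nonneg_left (sum_le_sum fun x hx => sum_le_sum fun i _ => ?_) (by positivity)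
  simp only [internalColumns, mem_filter] at hx
  exact add_le_add (pushOp_up_mono hx.2.1 hx.2.2 hf huv) (pushOp_down_mono hx.2.1 hx.2.2 hf huv)

lemma transition_mulVec_const (hN : 0 < ((sites a b c).card : ℝ)) (r : ℝ) :
    (transition a b c).mulVec (fun _ => r) = fun _ => r := by
  ext u
  rw [transition_mulVec]
  rw [card_sites] at hN ⊢
  simp only [colOp_of_forall_eq (f := fun _ => r) (fun _ _ => rfl), sum_const, nsmul_eq_mul]
  field_simp
  exact mul_div_cancel_left₀ _ hN.ne'

lemma pushProb_nonneg {up : Bool} : 0 ≤ pushProb u i x up v := by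
  obtain ⟨h1, h2⟩ := inv_card_tower_mem (u := u) (i := i) (x := x) up
  have h3 := sub_nonneg.2 h2
  rw [pushProb]
  split_ifs <;> linarith

lemma pushProb_self_of_not_isRouting {up : Bool} (h : ¬ IsRouting (pushed u i x up)) :
    pushProb u i x up u = 1 := by
  simp [pushProb, h]

lemma transition_nonneg : 0 ≤ transition a b c u v := by
  rw [transition_apply]
  exact mul_nonneg (by positivity) (sum_nonneg fun x _ => sum_nonneg fun i _ =>
    add_nonneg pushProb_nonneg pushProb_nonneg)

/-- A point cannot be both a valley and a peak, so at each site at least one of the two directions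
leaves the state unchanged. -/
lemma half_le_transition_self (hN : 0 < ((sites a b c).card : ℝ)) :
    1 / 2 ≤ transition a b c u u := by
  rw [transition_apply]
  have key : ((sites a b c).card : ℝ) ≤ ∑ x ∈ internalColumns a b, colKernel x u u := by
    rw [card_sites]
    have h1 : ∀ x ∈ internalColumns a b, (c : ℝ) ≤ colKernel x u u := by
      intro x hx
      simp only [internalColumns, mem_filter] at hx
      obtain ⟨y, z, hy, hz⟩ := exists_neighbours hx.2.1 hx.2.2
      have h2 : ∀ i ∈ (univ : Finset (Fin c)),
          (1 : ℝ) ≤ pushProb u i x true u + pushProb u i x false u := by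
        intro i _
        by_cases h : IsRouting (pushed u i x true)
        · have h2 : ¬ IsRouting (pushed u i x false) := by
            rw [isRouting_pushed_down_iff hy hz]
            rw [isRouting_pushed_up_iff hy hz] at h
            omega
          rw [pushProb_self_of_not_isRouting h2]
          linarith [pushProb_nonneg (u := u) (v := u) (i := i) (x := x) (up := true)]
        · rw [pushProb_self_of_not_isRouting h]
          linarith [pushProb_nonneg (u := u) (v := u) (i := i) (x := x) (up := false)]
      have := sum_le_sum h2
      simpa [colKernel] using this
    have := sum_le_sum h1
    simpa using this
  calc (1 / 2 : ℝ) = 1 / (2 * ((sites a b c).card : ℝ)) * ((sites a b c).card : ℝ) := by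
        field_simp
    _ ≤ _ := mul_le_mul_of_nonneg_left key (by positivity)

end Column

/-! ### Discrete sine sums -/

lemma sin_add_sin_two_step (θ : ℝ) (x : ℕ) :
    Real.sin (θ * x) + Real.sin (θ * (x + 2 : ℕ)) =
      2 * Real.cos θ * Real.sin (θ * (x + 1 : ℕ)) := by
  have h1 : θ * x = θ * (x + 1 : ℕ) - θ := by push_cast; ring
  have h2 : θ * (x + 2 : ℕ) = θ * (x + 1 : ℕ) + θ := by push_cast; ring
  rw [h1, h2, Real.sin_sub, Real.sin_add]
  ring

/-- Summation by parts: the boundary terms vanish because `t` and the sine are both zero at `0` and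
`m + 1`. It is used for the eigenvalue, for the variance and for the two extreme values of
`potential`. -/
lemma sum_laplacian_mul_sin {θ : ℝ} {m : ℕ} (hθ : Real.sin (θ * (m + 1 : ℕ)) = 0) {t : ℕ → ℝ}
    (h0 : t 0 = 0) (hm : t (m + 1) = 0) :
    ∑ x ∈ range m, (t x + t (x + 2) - 2 * t (x + 1)) * Real.sin (θ * (x + 1 : ℕ)) =
      (2 * Real.cos θ - 2) * ∑ x ∈ range m, t (x + 1) * Real.sin (θ * (x + 1 : ℕ)) := by
  have e1 : ∑ x ∈ range m, t x * Real.sin (θ * (x + 1 : ℕ)) =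
      ∑ x ∈ range m, t (x + 1) * Real.sin (θ * (x + 2 : ℕ)) := by
    have h1 := sum_range_succ (fun x => t x * Real.sin (θ * (x + 1 : ℕ))) m
    rw [sum_range_succ'] at h1
    simp only [h0, hθ, zero_mul, mul_zero, add_zero] at h1
    exact h1.symm
  have e2 : ∑ x ∈ range m, t (x + 2) * Real.sin (θ * (x + 1 : ℕ)) =
      ∑ x ∈ range m, t (x + 1) * Real.sin (θ * x) := by
    have h1 := sum_range_succ (fun x => t (x + 1) * Real.sin (θ * x)) m
    rw [sum_range_succ'] at h1
    simp only [hm, Nat.cast_zero, Real.sin_zero, zero_mul, mul_zero, add_zero] at h1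
    exact h1
  calc _ = ∑ x ∈ range m, t x * Real.sin (θ * (x + 1 : ℕ)) +
        ∑ x ∈ range m, t (x + 2) * Real.sin (θ * (x + 1 : ℕ)) -
        2 * ∑ x ∈ range m, t (x + 1) * Real.sin (θ * (x + 1 : ℕ)) := by
        rw [mul_sum, ← sum_add_distrib, ← sum_sub_distrib]
        exact sum_congr rfl fun x _ => by ring
    _ = ∑ x ∈ range m, t (x + 1) * (Real.sin (θ * x) + Real.sin (θ * (x + 2 : ℕ))) -
        2 * ∑ x ∈ range m, t (x + 1) * Real.sin (θ * (x + 1 : ℕ)) := by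
        rw [e1, e2, ← sum_add_distrib]
        congr 1
        exact sum_congr rfl fun x _ => by ring
    _ = _ := by
        rw [sub_mul, mul_sum _ _ (2 * Real.cos θ)]
        congr 1
        exact sum_congr rfl fun x _ => by rw [sin_add_sin_two_step]; ring

lemma sum_sin_sq {m : ℕ} (hm : 1 ≤ m) :
    ∑ x ∈ range m, Real.sin (Real.pi / (m + 1) * (x + 1 : ℕ)) ^ 2 = ((m : ℝ) + 1) / 2 := by
  set θ := Real.pi / (m + 1) with hθ
  have hm' : (1 : ℝ) ≤ m := by exact_mod_cast hm
  -- Here `1 ≤ m` matters: it gives `θ < π`, so the telescoping sum below may be divided by `sin θ`.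
  have hs : Real.sin θ ≠ 0 := by
    apply (Real.sin_pos_of_pos_of_lt_pi (by positivity) _).ne'
    rw [hθ, div_lt_iff₀ (by positivity)]
    nlinarith [Real.pi_pos]
  have tele : ∀ k : ℕ, ∑ x ∈ range k, 2 * Real.sin θ * Real.cos (2 * (θ * x)) =
      Real.sin ((2 * k - 1) * θ) + Real.sin θ := by
    intro k
    induction k with
    | zero => simp
    | succ k ih =>
      rw [sum_range_succ, ih]
      have e1 : (2 * ((k + 1 : ℕ) : ℝ) - 1) * θ = 2 * (θ * k) + θ := by push_cast; ring
      have e2 : (2 * (k : ℝ) - 1) * θ = 2 * (θ * k) - θ := by ring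
      rw [e1, e2, Real.sin_add, Real.sin_sub]
      ring
  have h0 : ∑ x ∈ range (m + 1), Real.cos (2 * (θ * x)) = 0 := by
    have h1 := tele (m + 1)
    have e1 : (2 * ((m + 1 : ℕ) : ℝ) - 1) * θ = 2 * Real.pi - θ := by
      rw [hθ]; push_cast; field_simp
    rw [e1, Real.sin_two_pi_sub, neg_add_cancel, ← mul_sum] at h1
    simpa [hs] using h1
  have h2 : ∑ x ∈ range (m + 1), Real.sin (θ * x) ^ 2 = ((m : ℝ) + 1) / 2 := by
    simp only [Real.sin_sq_eq_half_sub, sum_sub_distrib, ← sum_div, h0]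
    simp
  rw [sum_range_succ'] at h2
  simpa using h2

lemma eq_mul_of_midpoint {g : ℕ → ℝ} (h0 : g 0 = 0) {k : ℕ}
    (h : ∀ y, y + 1 < k → g y + g (y + 2) = 2 * g (y + 1)) :
    ∀ y, y ≤ k → g y = y * g 1 := by
  intro y
  induction y using Nat.strong_induction_on with
  | _ y ih =>
    intro hy
    match y with
    | 0 => simp [h0]
    | 1 => simp
    | y + 2 =>
      have h1 := ih y (by omega) (by omega)
      have h2 := ih (y + 1) (by omega) (by omega)
      have h3 := h y (by omega)
      push_cast at h2 ⊢
      linarith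

/-! ### Column heights under the uniform distribution -/

section Heights

variable {a b c : ℕ}

/-- The total height in column `x`, with columns indexed by natural numbers. -/
def columnHeightNat (x : ℕ) (u : Routing a b c) : ℝ :=
  if h : x < a + b + 1 then columnHeight ⟨x, h⟩ u else 0

/-- The centred total height in column `x`. -/
def centredHeight (x : ℕ) (u : Routing a b c) : ℝ :=
  columnHeightNat x u - mean (columnHeightNat (a := a) (b := b) (c := c) x)

lemma columnHeightNat_coe (x : Fin (a + b + 1)) :
    columnHeightNat (a := a) (b := b) (c := c) x = columnHeight x := by
  funext u
  rw [columnHeightNat, dif_pos x.2]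

lemma card_routing_pos : 0 < (Fintype.card (Routing a b c) : ℝ) := by
  exact_mod_cast Fintype.card_pos

lemma mean_const {X : Type*} [Fintype X] [Nonempty X] (r : ℝ) : mean (fun _ : X => r) = r := by
  have : (Fintype.card X : ℝ) ≠ 0 := by exact_mod_cast Fintype.card_ne_zero
  simp [mean, this]

lemma sum_eq_card_mul_mean {X : Type*} [Fintype X] [Nonempty X] (f : X → ℝ) :
    ∑ x, f x = Fintype.card X * mean f := by
  have : (Fintype.card X : ℝ) ≠ 0 := by exact_mod_cast Fintype.card_ne_zero
  rw [mean]
  field_simp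

lemma columnHeightNat_eq_of_const {x : ℕ} (h : ∀ u v : Routing a b c,
    columnHeightNat x u = columnHeightNat x v) (u : Routing a b c) : centredHeight x u = 0 := by
  have : columnHeightNat x = fun _ : Routing a b c => columnHeightNat x u :=
    funext fun v => h v u
  rw [centredHeight, this, mean_const, sub_self]

lemma centredHeight_zero (u : Routing a b c) : centredHeight 0 u = 0 := by
  apply columnHeightNat_eq_of_const
  intro u v
  have := columnHeightNat_coe (c := c) (0 : Fin (a + b + 1))
  rw [Fin.val_zero] at this
  rw [this]
  exact columnHeight_congr fun j => by rw [u.2.start, v.2.start]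

lemma centredHeight_last (u : Routing a b c) : centredHeight (a + b) u = 0 := by
  apply columnHeightNat_eq_of_const
  intro u v
  have := columnHeightNat_coe (c := c) (Fin.last (a + b))
  rw [Fin.val_last] at this
  rw [this]
  exact columnHeight_congr fun j => by rw [u.2.finish, v.2.finish]

lemma columnHeightNat_congr {x : ℕ} {u v : Routing a b c}
    (h : ∀ (j : Fin c) (y : Fin (a + b + 1)), (y : ℕ) = x → v.1 j y = u.1 j y) :
    columnHeightNat x v = columnHeightNat x u := by
  rw [columnHeightNat, columnHeightNat]
  split_ifs with hx
  · exact columnHeight_congr fun j => h j _ rfl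
  · rfl

lemma colOp_columnHeightNat {x : ℕ} (hx : x + 1 < a + b) (u : Routing a b c) :
    colOp ⟨x + 1, by omega⟩ (columnHeightNat (x + 1)) u = 2 * c * columnHeightNat (x + 1) u +
      (columnHeightNat x u + columnHeightNat (x + 2) u - 2 * columnHeightNat (x + 1) u) := by
  have := colOp_columnHeight (u := u) (x := ⟨x + 1, by omega⟩) (y := ⟨x, by omega⟩)
    (z := ⟨x + 1, by omega⟩) rfl rfl
  simp only [← columnHeightNat_coe] at this
  exact this

lemma colOp_columnHeightNat_of_ne {x : Fin (a + b + 1)} {w : ℕ} (hw : (x : ℕ) ≠ w)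
    (u : Routing a b c) : colOp x (columnHeightNat w) u = 2 * c * columnHeightNat w u :=
  colOp_of_forall_eq fun v h => columnHeightNat_congr fun j y hy =>
    h j y fun h => hw (by rw [← h, hy])

/-- The column operator is self-adjoint and acts as multiplication by `2 * c` on functions that do
not see column `x + 1`. Moving it from the height to `f` leaves only the Laplacian term, whose sum
must vanish. Both the means (`f = 1`) and the covariances are controlled this way. -/
lemma sum_mul_laplacian {x : ℕ} (hx : x + 1 < a + b) {f : Routing a b c → ℝ}
    (hf : ∀ u v : Routing a b c,
      (∀ j (y : Fin (a + b + 1)), (y : ℕ) ≠ x + 1 → v.1 j y = u.1 j y) → f v = f u) :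
    ∑ u, f u * (columnHeightNat x u + columnHeightNat (x + 2) u - 2 * columnHeightNat (x + 1) u) =
      0 := by
  have h := sum_mul_colOp ⟨x + 1, by omega⟩ f (columnHeightNat (x + 1))
  have h1 : ∀ u, colOp ⟨x + 1, by omega⟩ f u = 2 * c * f u := fun u =>
    colOp_of_forall_eq fun v hv => hf u v fun j y hy => hv j y fun hh => hy (by rw [hh])
  simp only [colOp_columnHeightNat hx, h1, mul_add, sum_add_distrib] at h ⊢
  have h2 : ∑ u, f u * (2 * c * columnHeightNat (x + 1) u) =
      ∑ u, 2 * c * f u * columnHeightNat (x + 1) u := sum_congr rfl fun u _ => by ring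
  rw [h2] at h
  linarith

lemma mean_laplacian {x : ℕ} (hx : x + 1 < a + b) :
    mean (columnHeightNat (a := a) (b := b) (c := c) x) +
      mean (columnHeightNat (a := a) (b := b) (c := c) (x + 2)) -
      2 * mean (columnHeightNat (a := a) (b := b) (c := c) (x + 1)) = 0 := by
  have h := sum_mul_laplacian (c := c) hx (f := fun _ => 1) (fun _ _ _ => rfl)
  simp only [one_mul, sum_add_distrib, sum_sub_distrib, ← mul_sum] at h
  simp only [mean]
  rw [← add_div, ← mul_div_assoc, ← sub_div, h, zero_div]

/-- The mean is affine in `x`, so centring does not affect second differences; the means themselves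
are never computed for general `x`. -/
lemma centredHeight_laplacian {x : ℕ} (hx : x + 1 < a + b) (u : Routing a b c) :
    centredHeight x u + centredHeight (x + 2) u - 2 * centredHeight (x + 1) u =
      columnHeightNat x u + columnHeightNat (x + 2) u - 2 * columnHeightNat (x + 1) u := by
  have := mean_laplacian (c := c) hx
  simp only [centredHeight]
  linarith

lemma sum_centredHeight (x : ℕ) : ∑ u : Routing a b c, centredHeight x u = 0 := by
  simp only [centredHeight, sum_sub_distrib, sum_const, card_univ, nsmul_eq_mul,
    sum_eq_card_mul_mean, sub_self]

/-- The covariance of two column heights, multiplied by the number of states. -/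
def heightCov (a b c x y : ℕ) : ℝ :=
  ∑ u : Routing a b c, centredHeight x u * centredHeight y u

lemma heightCov_comm (x y : ℕ) : heightCov a b c x y = heightCov a b c y x :=
  sum_congr rfl fun _ _ => mul_comm _ _

lemma heightCov_laplacian {x y : ℕ} (hy : y + 1 < a + b) (hxy : x ≠ y + 1) :
    heightCov a b c x y + heightCov a b c x (y + 2) = 2 * heightCov a b c x (y + 1) := by
  have h := sum_mul_laplacian (c := c) hy (f := fun u => centredHeight x u) fun u v huv => by
    simp only [centredHeight]
    rw [columnHeightNat_congr fun j z hz => huv j z (by omega)]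
  simp only [← centredHeight_laplacian hy] at h
  rw [← sub_eq_zero, ← h]
  simp only [heightCov, mul_sum, ← sum_add_distrib, ← sum_sub_distrib]
  exact sum_congr rfl fun u _ => by ring

lemma heightCov_zero (x : ℕ) : heightCov a b c x 0 = 0 := by
  simp [heightCov, centredHeight_zero]

lemma heightCov_last (x : ℕ) : heightCov a b c x (a + b) = 0 := by
  simp [heightCov, centredHeight_last]

lemma heightCov_one {y : ℕ} (h1 : 1 ≤ y) (hy : y ≤ a + b) :
    heightCov a b c 1 y = ((a + b : ℕ) - y) * heightCov a b c 1 (a + b - 1) := by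
  have key := eq_mul_of_midpoint (g := fun k => heightCov a b c 1 (a + b - k))
    (by simpa using heightCov_last 1) (k := a + b - 1) (fun k hk => by
      have h := heightCov_laplacian (c := c) (x := 1) (y := a + b - (k + 2)) (a := a) (b := b)
        (by omega) (by omega)
      rw [show a + b - (k + 2) + 2 = a + b - k by omega,
        show a + b - (k + 2) + 1 = a + b - (k + 1) by omega] at h
      rw [add_comm]
      exact h) (a + b - y) (by omega)
  simp only [show a + b - (a + b - y) = y by omega] at key
  rw [key, Nat.cast_sub hy]

/-- This is the Green function of the discrete Laplacian with zero boundary values: linear in each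
argument on either side of the diagonal. One unknown constant remains. -/
lemma heightCov_eq {x y : ℕ} (hxy : x ≤ y) (hy : y ≤ a + b) :
    heightCov a b c x y = x * ((a + b : ℕ) - y) * heightCov a b c 1 (a + b - 1) := by
  rcases Nat.eq_zero_or_pos y with rfl | h1
  · obtain rfl : x = 0 := by omega
    simp [heightCov_zero]
  have key := eq_mul_of_midpoint (g := fun k => heightCov a b c y k) (heightCov_zero y) (k := y)
    (fun k hk => heightCov_laplacian (by omega) (by omega)) x hxy
  rw [heightCov_comm, key, heightCov_comm, heightCov_one h1 hy]
  ring

end Heights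

/-! ### The potential -/

section Potential

variable {a b c : ℕ}

lemma potential_eq {m : ℕ} (hm : a + b = m + 1) (u : Routing a b c) :
    potential u =
      ∑ x ∈ range m, centredHeight (x + 1) u * Real.sin (Real.pi / (m + 1) * (x + 1 : ℕ)) := by
  have hm' : (a : ℝ) + b = m + 1 := by exact_mod_cast hm
  have h1 : potential u = ∑ x : Fin (a + b + 1),
      (fun x : ℕ => centredHeight x u * Real.sin (Real.pi / (m + 1) * x)) x := by
    simp only [potential, centredHeight, columnHeightNat_coe]
    refine sum_congr rfl fun x _ => ?_
    rw [hm', mul_div_right_comm]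
  rw [h1, Fin.sum_univ_eq_sum_range (fun x : ℕ => centredHeight x u *
    Real.sin (Real.pi / (m + 1) * x)), hm, sum_range_succ, sum_range_succ', ← hm]
  simp [centredHeight_zero, centredHeight_last]

lemma sin_angle_last (m : ℕ) : Real.sin (Real.pi / (m + 1) * (m + 1 : ℕ)) = 0 := by
  have : Real.pi / (m + 1) * (m + 1 : ℕ) = Real.pi := by push_cast; field_simp
  rw [this, Real.sin_pi]

lemma sum_potential : ∑ u : Routing a b c, potential u = 0 := by
  simp only [potential, ← columnHeightNat_coe]
  rw [sum_comm]
  refine sum_eq_zero fun x _ => ?_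
  rw [← sum_mul]
  have := sum_centredHeight (a := a) (b := b) (c := c) x
  simp only [centredHeight] at this
  rw [this, zero_mul]

/-- Each row of the covariance matrix has zero Laplacian except at the diagonal, where it equals
`-(m + 1)` times the Green constant. So the matrix maps the sine vector to a multiple of itself, and
`sum_sin_sq` finishes. -/
lemma sum_potential_sq {m : ℕ} (hm : a + b = m + 1) (h1 : 1 ≤ m) :
    (2 - 2 * Real.cos (Real.pi / (m + 1))) * ∑ u : Routing a b c, potential u ^ 2 =
      ((m : ℝ) + 1) ^ 2 / 2 * heightCov a b c 1 (a + b - 1) := by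
  set θ := Real.pi / (m + 1) with hθ
  have e1 : ∑ u : Routing a b c, potential u ^ 2 =
      ∑ x ∈ range m, (∑ y ∈ range m, heightCov a b c (x + 1) (y + 1) *
        Real.sin (θ * (y + 1 : ℕ))) * Real.sin (θ * (x + 1 : ℕ)) := by
    simp only [potential_eq hm, ← hθ, sq, heightCov, sum_mul, mul_sum]
    rw [sum_comm]
    refine sum_congr rfl fun x _ => ?_
    rw [sum_comm]
    refine sum_congr rfl fun y _ => sum_congr rfl fun u _ => ?_
    ring
  have e2 : ∀ x ∈ range m, (2 - 2 * Real.cos θ) * (∑ y ∈ range m,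
      heightCov a b c (x + 1) (y + 1) * Real.sin (θ * (y + 1 : ℕ))) =
      ((m : ℝ) + 1) * heightCov a b c 1 (a + b - 1) * Real.sin (θ * (x + 1 : ℕ)) := by
    intro x hx
    rw [mem_range] at hx
    have h := sum_laplacian_mul_sin (m := m) (sin_angle_last m)
      (t := fun y => heightCov a b c (x + 1) y) (heightCov_zero _)
      (by rw [← hm]; exact heightCov_last _)
    rw [← hθ, sum_eq_single x] at h
    · have h' : heightCov a b c (x + 1) x + heightCov a b c (x + 1) (x + 2) -
          2 * heightCov a b c (x + 1) (x + 1) =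
          - (((m : ℝ) + 1) * heightCov a b c 1 (a + b - 1)) := by
        rw [heightCov_comm (x + 1) x, heightCov_eq (by omega) (by omega),
          heightCov_eq (x := x + 1) (y := x + 2) (by omega) (by omega),
          heightCov_eq (x := x + 1) (y := x + 1) (by omega) (by omega), hm]
        push_cast
        ring
      rw [h'] at h
      linarith
    · intro y hy hyx
      rw [mem_range] at hy
      have := heightCov_laplacian (a := a) (b := b) (c := c) (x := x + 1) (y := y) (by omega)
        (by omega)
      simp only [this, sub_self, zero_mul]
    · intro hx'
      exact absurd (mem_range.2 hx) hx'
  rw [e1, mul_sum]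
  calc _ = ∑ x ∈ range m, ((m : ℝ) + 1) * heightCov a b c 1 (a + b - 1) *
        Real.sin (θ * (x + 1 : ℕ)) ^ 2 := by
        refine sum_congr rfl fun x hx => ?_
        rw [← mul_assoc, e2 x hx]
        ring
    _ = _ := by
        rw [← mul_sum, hθ, sum_sin_sq h1]
        ring

lemma transition_mulVec_centredHeight (hN : 0 < ((sites a b c).card : ℝ)) {x : ℕ}
    (hx : x + 1 < a + b) (u : Routing a b c) :
    (transition a b c).mulVec (centredHeight (x + 1)) u = centredHeight (x + 1) u +
      1 / (2 * ((sites a b c).card : ℝ)) *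
        (centredHeight x u + centredHeight (x + 2) u - 2 * centredHeight (x + 1) u) := by
  have h0 : (centredHeight (x + 1) : Routing a b c → ℝ) = columnHeightNat (x + 1) -
      fun _ => mean (columnHeightNat (a := a) (b := b) (c := c) (x + 1)) := rfl
  rw [h0, Matrix.mulVec_sub, transition_mulVec_const hN, ← h0, centredHeight_laplacian hx,
    Pi.sub_apply, transition_mulVec]
  have h1 : ∀ y ∈ internalColumns a b, colOp y (columnHeightNat (x + 1)) u =
      2 * c * columnHeightNat (x + 1) u + if y = ⟨x + 1, by omega⟩ then
        columnHeightNat x u + columnHeightNat (x + 2) u - 2 * columnHeightNat (x + 1) u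
        else 0 := by
    intro y _
    split_ifs with hy
    · rw [hy, colOp_columnHeightNat hx]
    · rw [colOp_columnHeightNat_of_ne (fun h => hy (Fin.ext h)), add_zero]
  have hmem : (⟨x + 1, by omega⟩ : Fin (a + b + 1)) ∈ internalColumns a b := by
    simp only [internalColumns, mem_filter, mem_univ, true_and, Fin.ext_iff, ne_eq, Fin.val_zero,
      Fin.val_last]
    omega
  rw [sum_congr rfl h1, sum_add_distrib, sum_ite_eq', if_pos hmem, sum_const, nsmul_eq_mul,
    centredHeight]
  rw [card_sites] at hN ⊢
  have hc : (c : ℝ) ≠ 0 := right_ne_zero_of_mul hN.ne'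
  have hI : ((internalColumns a b).card : ℝ) ≠ 0 := left_ne_zero_of_mul hN.ne'
  field_simp
  ring

/-- The eigenvalue of the potential. -/
def potentialEigenvalue (a b c : ℕ) : ℝ :=
  1 - (1 - Real.cos (Real.pi / ((a : ℝ) + b))) / (sites a b c).card

/-- On centred heights the chain is the identity plus `1 / (2 N)` times the Laplacian, `N` the
number of sites. The Laplacian contributes `2 cos θ - 2` on the sine vector, `θ = π / (a + b)`. -/
lemma transition_mulVec_potential (hN : 0 < ((sites a b c).card : ℝ)) {m : ℕ}
    (hm : a + b = m + 1) :
    (transition a b c).mulVec potential = potentialEigenvalue a b c • potential := by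
  have h0 : (potential : Routing a b c → ℝ) = ∑ x ∈ range m,
      Real.sin (Real.pi / (m + 1) * (x + 1 : ℕ)) • centredHeight (x + 1) := by
    funext u
    rw [potential_eq hm, Finset.sum_apply]
    exact sum_congr rfl fun x _ => mul_comm _ _
  funext u
  have h1 : (transition a b c).mulVec potential u = ∑ x ∈ range m,
      Real.sin (Real.pi / (m + 1) * (x + 1 : ℕ)) *
        (transition a b c).mulVec (centredHeight (x + 1)) u := by
    rw [h0, Matrix.mulVec_sum, Finset.sum_apply]
    exact sum_congr rfl fun x _ => by rw [Matrix.mulVec_smul]; rfl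
  have h2 := sum_laplacian_mul_sin (m := m) (sin_angle_last m)
    (t := fun y => centredHeight y u) (centredHeight_zero _)
    (by rw [← hm]; exact centredHeight_last _)
  have h3 : ∀ x ∈ range m, Real.sin (Real.pi / (m + 1) * (x + 1 : ℕ)) *
        (transition a b c).mulVec (centredHeight (x + 1)) u =
      centredHeight (x + 1) u * Real.sin (Real.pi / (m + 1) * (x + 1 : ℕ)) +
      1 / (2 * ((sites a b c).card : ℝ)) *
        ((centredHeight x u + centredHeight (x + 2) u - 2 * centredHeight (x + 1) u) *
          Real.sin (Real.pi / (m + 1) * (x + 1 : ℕ))) := by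
    intro x hx
    rw [mem_range] at hx
    rw [transition_mulVec_centredHeight hN (by omega)]
    ring
  have hm' : (a : ℝ) + b = m + 1 := by exact_mod_cast hm
  rw [h1, sum_congr rfl h3, sum_add_distrib, ← mul_sum, h2, ← potential_eq hm, Pi.smul_apply,
    smul_eq_mul, potentialEigenvalue, hm']
  field_simp
  ring

/-- The bottom state: every path makes its down steps first. -/
def bottomRouting (a b c : ℕ) : Routing a b c :=
  ⟨fun i x => (i : ℕ) + ((x : ℕ) - b : ℕ), by
    refine ⟨fun i => by simp, fun i => by simp, fun i x => ?_, fun i j h x => ?_⟩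
    · simp only [Fin.val_succ, Fin.val_castSucc]
      omega
    · have : (i : ℕ) < j := h
      omega⟩

lemma bottomRouting_le (v : Routing a b c) : bottomRouting a b c ≤ v := by
  intro i x
  change ((i : ℕ) : ℤ) + ((x : ℕ) - b : ℕ) ≤ v.1 i x
  have h1 : ∀ x : Fin (a + b + 1), ((i : ℕ) : ℤ) + ((x : ℕ) : ℤ) - b ≤ v.1 i x := by
    intro x
    induction x using Fin.reverseInduction with
    | last =>
      have := v.2.finish i
      rw [Fin.val_last]
      push_cast
      omega
    | cast y ih =>
      have := v.2.step i y
      simp only [Fin.val_succ, Fin.val_castSucc] at ih ⊢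
      push_cast at ih
      omega
  have h2 : ∀ x : Fin (a + b + 1), ((i : ℕ) : ℤ) ≤ v.1 i x := by
    intro x
    induction x using Fin.induction with
    | zero => rw [v.2.start]
    | succ y ih =>
      have := v.2.step i y
      omega
  have := h1 x
  have := h2 x
  omega

lemma columnHeightNat_top {x : ℕ} (hx : x ≤ a + b) :
    columnHeightNat x (⊤ : Routing a b c) =
      ∑ i : Fin c, ((i : ℕ) : ℝ) + c * ((min x a : ℕ) - (x : ℝ) / 2) := by
  rw [columnHeightNat, dif_pos (by omega)]
  have h : ∀ i : Fin c, height (⊤ : Routing a b c) i ⟨x, by omega⟩ =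
      ((i : ℕ) : ℝ) + ((min x a : ℕ) - (x : ℝ) / 2) := by
    intro i
    change ((((i : ℕ) : ℤ) + (min x a : ℕ) : ℤ) : ℝ) - (x : ℝ) / 2 = _
    push_cast
    ring
  simp only [columnHeight, h, sum_add_distrib, sum_const, card_univ, Fintype.card_fin,
    nsmul_eq_mul]

lemma columnHeightNat_bottom {x : ℕ} (hx : x ≤ a + b) :
    columnHeightNat x (bottomRouting a b c) =
      ∑ i : Fin c, ((i : ℕ) : ℝ) + c * ((x - b : ℕ) - (x : ℝ) / 2) := by
  rw [columnHeightNat, dif_pos (by omega)]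
  have h : ∀ i : Fin c, height (bottomRouting a b c) i ⟨x, by omega⟩ =
      ((i : ℕ) : ℝ) + ((x - b : ℕ) - (x : ℝ) / 2) := by
    intro i
    change ((((i : ℕ) : ℤ) + ((x - b : ℕ) : ℤ) : ℤ) : ℝ) - (x : ℝ) / 2 = _
    push_cast
    ring
  simp only [columnHeight, h, sum_add_distrib, sum_const, card_univ, Fintype.card_fin,
    nsmul_eq_mul]

/-- For a state whose column heights have a single kink, at column `k`, summation by parts leaves
one term. The top state has its kink at `a`, the bottom state at `b`. -/
lemma potential_of_laplacian {m k : ℕ} (hm : a + b = m + 1) (hk : 1 ≤ k) (hkm : k ≤ m)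
    {u : Routing a b c} {r : ℝ}
    (h : ∀ x, x + 1 < a + b → columnHeightNat x u + columnHeightNat (x + 2) u -
      2 * columnHeightNat (x + 1) u = if x + 1 = k then r else 0) :
    (2 * Real.cos (Real.pi / (m + 1)) - 2) * potential u = r * Real.sin (Real.pi / (m + 1) * k) := by
  have h2 := sum_laplacian_mul_sin (m := m) (sin_angle_last m)
    (t := fun y => centredHeight y u) (centredHeight_zero _)
    (by rw [← hm]; exact centredHeight_last _)
  rw [potential_eq hm, ← h2, sum_eq_single (k - 1)]
  · rw [centredHeight_laplacian (by omega), h _ (by omega), if_pos (by omega),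
      show k - 1 + 1 = k by omega]
  · intro x hx hxk
    rw [mem_range] at hx
    rw [centredHeight_laplacian (by omega), h _ (by omega), if_neg (by omega), zero_mul]
  · intro hk'
    exact absurd (mem_range.2 (by omega)) hk'

lemma potential_top {m : ℕ} (hm : a + b = m + 1) (ha : 1 ≤ a) (hb : 1 ≤ b) :
    (2 * Real.cos (Real.pi / (m + 1)) - 2) * potential (⊤ : Routing a b c) =
      -c * Real.sin (Real.pi / (m + 1) * a) := by
  refine potential_of_laplacian hm ha (by omega) fun x hx => ?_
  rw [columnHeightNat_top (by omega), columnHeightNat_top (by omega),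
    columnHeightNat_top (by omega)]
  split_ifs with h
  · rw [min_eq_left (by omega : x ≤ a), min_eq_right (by omega : a ≤ x + 2),
      min_eq_right (by omega : a ≤ x + 1), ← h]
    push_cast
    ring
  · rcases lt_or_gt_of_ne h with h | h
    · rw [min_eq_left (by omega : x ≤ a), min_eq_left (by omega : x + 2 ≤ a),
        min_eq_left (by omega : x + 1 ≤ a)]
      push_cast
      ring
    · rw [min_eq_right (by omega : a ≤ x), min_eq_right (by omega : a ≤ x + 2),
        min_eq_right (by omega : a ≤ x + 1)]
      push_cast
      ring

lemma potential_bottom {m : ℕ} (hm : a + b = m + 1) (ha : 1 ≤ a) (hb : 1 ≤ b) :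
    (2 * Real.cos (Real.pi / (m + 1)) - 2) * potential (bottomRouting a b c) =
      c * Real.sin (Real.pi / (m + 1) * b) := by
  refine potential_of_laplacian hm hb (by omega) fun x hx => ?_
  rw [columnHeightNat_bottom (by omega), columnHeightNat_bottom (by omega),
    columnHeightNat_bottom (by omega)]
  split_ifs with h
  · rw [show x - b = 0 by omega, show x + 2 - b = 1 by omega, show x + 1 - b = 0 by omega]
    push_cast
    ring
  · rcases lt_or_gt_of_ne h with h | h
    · rw [show x - b = 0 by omega, show x + 2 - b = 0 by omega, show x + 1 - b = 0 by omega]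
      push_cast
      ring
    · rw [show x + 2 - b = (x - b) + 2 by omega, show x + 1 - b = (x - b) + 1 by omega]
      push_cast
      ring

lemma one_sub_cos_pos {m : ℕ} (h1 : 1 ≤ m) : 0 < 1 - Real.cos (Real.pi / (m + 1)) := by
  have hm' : (1 : ℝ) ≤ m := by exact_mod_cast h1
  have h : 0 < Real.pi / (m + 1) := by positivity
  have h' : Real.pi / (m + 1) ≤ Real.pi := div_le_self Real.pi_pos.le (by linarith)
  have := Real.cos_lt_cos_of_nonneg_of_le_pi le_rfl h' h
  rw [Real.cos_zero] at this
  linarith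

/-- The kinks have opposite signs, and the sine takes equal values at the mirror columns `a` and
`b`. -/
lemma potential_bottom_eq_neg_top (ha : 1 ≤ a) (hb : 1 ≤ b) :
    potential (bottomRouting a b c) = -potential (⊤ : Routing a b c) := by
  obtain ⟨m, hm⟩ : ∃ m, a + b = m + 1 := ⟨a + b - 1, by omega⟩
  have h1 := potential_top (c := c) hm ha hb
  have h2 := potential_bottom (c := c) hm ha hb
  have h3 : Real.sin (Real.pi / (m + 1) * b) = Real.sin (Real.pi / (m + 1) * a) := by
    rw [← Real.sin_pi_sub]
    congr 1
    have hm' : (a : ℝ) + b = m + 1 := by exact_mod_cast hm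
    rw [← hm']
    have : (a : ℝ) + b ≠ 0 := by rw [hm']; positivity
    field_simp
    ring
  have h4 := one_sub_cos_pos (show 1 ≤ m by omega)
  have h5 : (2 * Real.cos (Real.pi / (m + 1)) - 2) ≠ 0 := by linarith
  apply mul_left_cancel₀ h5
  rw [h2, h3]
  linarith

lemma potential_strictMono : StrictMono (potential : Routing a b c → ℝ) := by
  intro u v huv
  have hle : ∀ j w, u.1 j w ≤ v.1 j w := huv.le
  have hex : ∃ j w, u.1 j w < v.1 j w := by
    by_contra! hcon
    exact huv.not_ge fun j w => hcon j w
  obtain ⟨j, w, hw⟩ := hex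
  have hw0 : w ≠ 0 := fun h => by
    subst h
    rw [u.2.start, v.2.start] at hw
    exact lt_irrefl _ hw
  have hwl : w ≠ Fin.last (a + b) := fun h => by
    subst h
    rw [u.2.finish, v.2.finish] at hw
    exact lt_irrefl _ hw
  have hcol : ∀ x, columnHeight x u ≤ columnHeight x v := fun x =>
    sum_le_sum fun i _ => by
      have : (u.1 i x : ℝ) ≤ v.1 i x := by exact_mod_cast hle i x
      simp only [height]
      linarith
  have hcolw : columnHeight w u < columnHeight w v := by
    refine sum_lt_sum (fun i _ => ?_) ⟨j, mem_univ _, ?_⟩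
    · have : (u.1 i w : ℝ) ≤ v.1 i w := by exact_mod_cast hle i w
      simp only [height]
      linarith
    · have : (u.1 j w : ℝ) < v.1 j w := by exact_mod_cast hw
      simp only [height]
      linarith
  have hw0' : 0 < (w : ℕ) := Nat.pos_of_ne_zero fun h => hw0 (Fin.ext h)
  have hwl' : (w : ℕ) < a + b := by
    have h1 := w.2
    have h2 : (w : ℕ) ≠ a + b := fun h => hwl (Fin.ext h)
    omega
  have hab : (0 : ℝ) < (a : ℝ) + b := by
    have : 0 < a + b := by omega
    exact_mod_cast this
  refine sum_lt_sum (fun x _ => ?_) ⟨w, mem_univ _, ?_⟩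
  · refine mul_le_mul_of_nonneg_right (sub_le_sub_right (hcol x) _) ?_
    apply Real.sin_nonneg_of_nonneg_of_le_pi (by positivity)
    rw [div_le_iff₀ hab]
    have : ((x : ℕ) : ℝ) ≤ (a : ℝ) + b := by
      have := x.2
      exact_mod_cast (by omega : (x : ℕ) ≤ a + b)
    exact mul_le_mul_of_nonneg_left this Real.pi_pos.le
  · refine mul_lt_mul_of_pos_right (sub_lt_sub_right hcolw _) ?_
    have hw0'' : (0 : ℝ) < ((w : ℕ) : ℝ) := by exact_mod_cast hw0'
    apply Real.sin_pos_of_pos_of_lt_pi (by positivity)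
    rw [div_lt_iff₀ hab]
    have : ((w : ℕ) : ℝ) < (a : ℝ) + b := by exact_mod_cast hwl'
    exact mul_lt_mul_of_pos_left this Real.pi_pos

end Potential

/-! ### Counting nonintersecting walks with a packed end -/

section Walks

variable {c : ℕ}

/-- Families of `c` nonintersecting walks with `T` steps from `A` to `f, f + 1, …, f + c - 1`. -/
abbrev Walk (f : ℤ) (T : ℕ) (A : Fin c → ℤ) : Type :=
  {w : Fin (T + 1) → Fin c → ℤ // w 0 = A ∧ w (Fin.last T) = (fun i : Fin c => f + ((i : ℕ) : ℤ)) ∧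
    (∀ (x : Fin T) i, w x.succ i = w x.castSucc i ∨ w x.succ i = w x.castSucc i + 1) ∧
    ∀ x, StrictMono (w x)}

/-- The positions after the steps recorded by `ε`. -/
def stepped (A : Fin c → ℤ) (ε : Fin c → Bool) : Fin c → ℤ :=
  fun i => A i + if ε i then 1 else 0

/-- Splitting off the first step. -/
def walkSuccEquiv (f : ℤ) (T : ℕ) {A : Fin c → ℤ} (hA : StrictMono A) :
    Walk f (T + 1) A ≃ Σ ε : Fin c → Bool, Walk f T (stepped A ε) where
  toFun w := ⟨fun i => decide (w.1 1 i = A i + 1), fun x => w.1 x.succ, by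
    refine ⟨?_, w.2.2.1, fun x => w.2.2.2.1 x.succ, fun x => w.2.2.2.2 x.succ⟩
    funext i
    have h := w.2.2.2.1 0 i
    have h0 : w.1 (Fin.castSucc 0) i = A i := congrFun w.2.1 i
    rw [h0] at h
    change w.1 1 i = A i ∨ w.1 1 i = A i + 1 at h
    change w.1 1 i = stepped A _ i
    rcases h with h | h <;> simp [stepped, h]⟩
  invFun p := ⟨Fin.cons A p.2.1, by
    obtain ⟨ε, w, h0, hl, hs, hm⟩ := p
    refine ⟨rfl, ?_, fun x i => ?_, fun x => ?_⟩
    · rw [← Fin.succ_last, Fin.cons_succ]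
      exact hl
    · refine Fin.cases ?_ (fun x => ?_) x
      · rw [Fin.castSucc_zero, Fin.cons_succ, Fin.cons_zero]
        have h1 : w 0 i = A i ∨ w 0 i = A i + 1 := by
          rw [h0]
          simp only [stepped]
          split_ifs <;> simp
        exact h1
      · rw [← Fin.succ_castSucc, Fin.cons_succ, Fin.cons_succ]
        exact hs x i
    · refine Fin.cases ?_ (fun x => ?_) x
      · rw [Fin.cons_zero]; exact hA
      · rw [Fin.cons_succ]; exact hm x⟩
  left_inv w := by
    apply Subtype.ext
    funext x
    refine Fin.cases ?_ (fun x => ?_) x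
    · exact w.2.1.symm
    · rfl
  right_inv p := by
    obtain ⟨ε, w, h0, hl, hs, hm⟩ := p
    refine Sigma.subtype_ext ?_ rfl
    funext i
    have : (Fin.cons A w : Fin (T + 1 + 1) → Fin c → ℤ) 1 = w 0 := rfl
    simp only [this, h0, stepped]
    cases ε i <;> simp

lemma isEmpty_walk {f : ℤ} {T : ℕ} {A : Fin c → ℤ} (hA : ¬ StrictMono A) :
    IsEmpty (Walk f T A) :=
  ⟨fun w => hA (w.2.1 ▸ w.2.2.2.2 0)⟩

lemma subsingleton_walk_zero {f : ℤ} {A : Fin c → ℤ} : Subsingleton (Walk f 0 A) :=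
  ⟨fun w w' => Subtype.ext (funext fun x => by
    rw [show x = 0 from Fin.ext (by omega), w.2.1, w'.2.1])⟩

lemma finite_walk (f : ℤ) (T : ℕ) : ∀ A : Fin c → ℤ, Finite (Walk f T A) := by
  induction T with
  | zero =>
    intro A
    have := subsingleton_walk_zero (f := f) (A := A)
    infer_instance
  | succ T ih =>
    intro A
    by_cases hA : StrictMono A
    · have := ih
      exact Finite.of_equiv _ (walkSuccEquiv f T hA).symm
    · have := isEmpty_walk (f := f) (T := T + 1) hA
      infer_instance

instance fintypeWalk (f : ℤ) (T : ℕ) (A : Fin c → ℤ) : Fintype (Walk f T A) :=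
  @Fintype.ofFinite _ (finite_walk f T A)

lemma sum_walk_succ {f : ℤ} {T : ℕ} {A : Fin c → ℤ} (hA : StrictMono A) (G : (Fin c → ℤ) → ℝ) :
    ∑ w : Walk f (T + 1) A, G (w.1 1) =
      ∑ ε : Fin c → Bool, Fintype.card (Walk f T (stepped A ε)) * G (stepped A ε) := by
  rw [← (walkSuccEquiv f T hA).symm.sum_comp, Fintype.sum_sigma]
  refine sum_congr rfl fun ε _ => ?_
  have h : ∀ w : Walk f T (stepped A ε),
      G (((walkSuccEquiv f T hA).symm ⟨ε, w⟩).1 1) = G (stepped A ε) := fun w => by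
    rw [← w.2.1]
    rfl
  simp only [h, sum_const, card_univ, nsmul_eq_mul]

lemma card_walk_succ {f : ℤ} {T : ℕ} {A : Fin c → ℤ} (hA : StrictMono A) :
    (Fintype.card (Walk f (T + 1) A) : ℝ) =
      ∑ ε : Fin c → Bool, (Fintype.card (Walk f T (stepped A ε)) : ℝ) := by
  have := sum_walk_succ (f := f) (T := T) hA fun _ => 1
  simpa using this

/-- The inverse factorial, extended by zero to the negative integers. -/
def invFactorial (z : ℤ) : ℝ := if 0 ≤ z then 1 / (z.toNat.factorial : ℝ) else 0

lemma invFactorial_natCast (k : ℕ) : invFactorial k = 1 / (k.factorial : ℝ) := by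
  simp [invFactorial]

/-- Extension by zero makes the recurrence valid at every integer, including `z = 0`. Hence walks
that overshoot their targets need no separate treatment. -/
lemma invFactorial_sub_one (z : ℤ) : invFactorial (z - 1) = z * invFactorial z := by
  rcases lt_trichotomy z 0 with h | h | h
  · rw [invFactorial, invFactorial, if_neg (by omega), if_neg (by omega), mul_zero]
  · subst h
    simp [invFactorial]
  · obtain ⟨k, rfl⟩ : ∃ k : ℕ, z = k + 1 := ⟨(z - 1).toNat, by omega⟩
    rw [add_sub_cancel_right, invFactorial_natCast,
      show (k : ℤ) + 1 = ((k + 1 : ℕ) : ℤ) by push_cast; rfl, invFactorial_natCast,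
      Nat.factorial_succ]
    have : (k.factorial : ℝ) ≠ 0 := by exact_mod_cast k.factorial_ne_zero
    push_cast
    field_simp

lemma vandermonde_det_pos {v : Fin c → ℝ} (hv : StrictMono v) :
    0 < (Matrix.vandermonde v).det := by
  rw [Matrix.det_vandermonde]
  exact prod_pos fun i _ => prod_pos fun j hj => sub_pos.2 (hv (mem_Ioi.1 hj))

/-- Multilinearity of the determinant in its rows: summing over independent choices in each row sums
the rows. It collapses the sum over all first steps into one determinant. -/
lemma sum_prod_mul_det {c : ℕ} (wt : Fin c → Bool → ℝ) (g : Fin c → Bool → Fin c → ℝ) :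
    ∑ ε : Fin c → Bool, (Matrix.of fun i j => g i (ε i) j).det * ∏ i, wt i (ε i) =
      (Matrix.of fun i j => ∑ s, wt i s * g i s j).det := by
  have h := (Matrix.detRowAlternating (n := Fin c) (R := ℝ)).toMultilinearMap.map_sum
    (fun i s => wt i s • g i s)
  have h1 : (Matrix.of fun i j => ∑ s, wt i s * g i s j) = fun i => ∑ s, wt i s • g i s := by
    ext i j
    rw [Finset.sum_apply]
    rfl
  rw [h1]
  refine Eq.trans ?_ h.symm
  refine sum_congr rfl fun ε _ => ?_
  rw [MultilinearMap.map_smul_univ, smul_eq_mul, mul_comm]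
  rfl

open Polynomial in
-- Column `j` is a polynomial in the node: the terms of degree `j + 1` cancel, and the coefficient
-- of degree `j` is `α + β - j`. So the matrix is Vandermonde times triangular.
lemma det_shifted_vandermonde (α β : ℝ) (v : Fin c → ℝ) :
    (Matrix.of fun i (j : Fin c) => (α + v i) * v i ^ (j : ℕ) +
      (β - v i) * (v i + 1) ^ (j : ℕ)).det =
      (∏ j : Fin c, (α + β - (j : ℕ))) * (Matrix.vandermonde v).det := by
  set p : ℕ → ℝ[X] := fun j => C α * X ^ j + C β * (X + 1) ^ j + X * X ^ j - X * (X + 1) ^ j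
    with hp
  have hcoeff : ∀ j k : ℕ, j < k → (p j).coeff k = 0 := by
    intro j k hjk
    obtain ⟨k, rfl⟩ : ∃ l, k = l + 1 := ⟨k - 1, by omega⟩
    simp only [hp, coeff_sub, coeff_add, coeff_C_mul, coeff_X_mul, coeff_X_add_one_pow,
      coeff_X_pow]
    rw [if_neg (by omega), Nat.choose_eq_zero_of_lt hjk]
    rcases Nat.lt_or_ge j k with h | h
    · rw [if_neg (by omega), Nat.choose_eq_zero_of_lt h]
      simp
    · obtain rfl : k = j := by omega
      simp
  have hlead : ∀ j : ℕ, (p j).coeff j = α + β - j := by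
    intro j
    rcases j with _ | j
    · simp [hp]
    · simp only [hp, coeff_sub, coeff_add, coeff_C_mul, coeff_X_mul, coeff_X_add_one_pow,
        coeff_X_pow]
      rw [if_pos trivial, if_neg (Nat.succ_ne_self j).symm, Nat.choose_self,
        Nat.choose_succ_self_right]
      push_cast
      ring
  have heval : (Matrix.of fun i (j : Fin c) => (α + v i) * v i ^ (j : ℕ) +
      (β - v i) * (v i + 1) ^ (j : ℕ)) = Matrix.of fun i (j : Fin c) => (p j).eval (v i) := by
    ext i j
    simp only [hp, Matrix.of_apply, eval_sub, eval_add, eval_mul, eval_pow, eval_X, eval_C,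
      eval_one]
    ring
  rw [heval, Matrix.eval_matrixOfPolynomials_eq_vandermonde_mul_matrixOfPolynomials v
    (fun j => p j) (fun j => natDegree_le_iff_coeff_eq_zero.2 fun k hk => hcoeff j k hk),
    Matrix.det_mul, mul_comm, Matrix.det_of_isUpperTriangular]
  · simp only [Matrix.of_apply, hlead]
  · intro i j hij
    exact hcoeff _ _ hij

/-- The factor of the walk count that comes from a single starting point. -/
def pointWeight (c : ℕ) (f : ℤ) (T : ℕ) (z : ℤ) : ℝ :=
  invFactorial (f + c - 1 - z) * invFactorial (T - f + z)

lemma pointWeight_step (c : ℕ) (f : ℤ) (T : ℕ) (z : ℤ) (s : Bool) :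
    pointWeight c f T (z + if s then 1 else 0) = pointWeight c f (T + 1) z *
      (if s then ((f : ℝ) + c - 1 - z) else ((T : ℝ) + 1 - f + z)) := by
  cases s
  · have h := invFactorial_sub_one ((T + 1 : ℕ) - f + z)
    rw [show ((T + 1 : ℕ) : ℤ) - f + z - 1 = T - f + z by push_cast; ring] at h
    simp only [pointWeight, Bool.false_eq_true, if_false, add_zero, h]
    push_cast
    ring
  · have h := invFactorial_sub_one (f + c - 1 - z)
    simp only [pointWeight, if_true]
    rw [show f + c - 1 - (z + 1) = f + c - 1 - z - 1 by ring, h,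
      show (T : ℤ) - f + (z + 1) = ((T + 1 : ℕ) : ℤ) - f + z by push_cast; ring]
    push_cast
    ring

/-- Steps are `0` or `1`, so a strict order can fail only through a coincidence. Colliding first
steps thus contribute zero to the product formula too, and the sum may run over all `ε`. -/
lemma vandermonde_stepped_eq_zero {A : Fin c → ℤ} (hA : StrictMono A) {ε : Fin c → Bool}
    (h : ¬ StrictMono (stepped A ε)) :
    (Matrix.vandermonde fun i => (stepped A ε i : ℝ)).det = 0 := by
  rw [Matrix.det_vandermonde_eq_zero_iff]
  simp only [StrictMono, not_forall, not_lt] at h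
  obtain ⟨i, j, hij, hle⟩ := h
  refine ⟨i, j, ?_, hij.ne⟩
  have h1 := hA hij
  have h2 : stepped A ε i = stepped A ε j := by
    simp only [stepped] at hle ⊢
    split_ifs at hle ⊢ <;> omega
  rw [h2]

/-- The product formula for the number of families of nonintersecting walks with a packed end. -/
theorem card_walk_eq (f : ℤ) (T : ℕ) : ∃ κ : ℝ, 0 < κ ∧ ∀ A : Fin c → ℤ, StrictMono A →
    (Fintype.card (Walk f T A) : ℝ) =
      κ * ((Matrix.vandermonde fun i => (A i : ℝ)).det * ∏ i, pointWeight c f T (A i)) := by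
  induction T with
  | zero =>
    set e : Fin c → ℤ := fun i => f + (i : ℕ) with he
    have hmono : StrictMono e := fun i j h => by
      have : (i : ℕ) < j := h
      simp only [he]
      omega
    have hpos : 0 < (Matrix.vandermonde fun i => (e i : ℝ)).det *
        ∏ i, pointWeight c f 0 (e i) := by
      refine mul_pos (vandermonde_det_pos fun i j h => ?_) (prod_pos fun i _ => ?_)
      · exact_mod_cast hmono h
      · have := i.2
        simp only [pointWeight, he, invFactorial]
        rw [if_pos (by omega), if_pos (by push_cast; omega)]
        positivity
    refine ⟨_, inv_pos.2 hpos, fun A hA => ?_⟩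
    have hsub := subsingleton_walk_zero (f := f) (A := A)
    by_cases hAe : A = e
    · subst hAe
      rw [inv_mul_cancel₀ hpos.ne']
      have : Nonempty (Walk f 0 e) := ⟨⟨fun _ => e, rfl, rfl, fun x => x.elim0, fun _ => hmono⟩⟩
      have h1 : Fintype.card (Walk f 0 e) = 1 :=
        le_antisymm (Fintype.card_le_one_iff_subsingleton.2 hsub) Fintype.card_pos
      rw [h1, Nat.cast_one]
    · have : IsEmpty (Walk f 0 A) := ⟨fun w => hAe (w.2.1.symm.trans w.2.2.1)⟩
      rw [Fintype.card_eq_zero, Nat.cast_zero]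
      -- At `T = 0` a weight is nonzero only on `[f, f + c - 1]`, and the only strictly increasing
      -- choice of `c` integers there is the packed one.
      suffices h : ∃ i, pointWeight c f 0 (A i) = 0 by
        obtain ⟨i, hi⟩ := h
        have h0 : ∏ i, pointWeight c f 0 (A i) = 0 := prod_eq_zero (mem_univ i) hi
        rw [h0, mul_zero, mul_zero]
      by_contra! hcon
      apply hAe
      have hb : ∀ i, f ≤ A i ∧ A i ≤ f + c - 1 := by
        intro i
        have := hcon i
        simp only [pointWeight, invFactorial] at this
        split_ifs at this with h1 h2
        · push_cast at h2
          omega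
        all_goals simp at this
      funext i
      have hi := i.2
      have g1 := le_sub_of_strictMono hA (i := ⟨0, by omega⟩) (j := i) (Fin.mk_le_of_le_val (by simp))
      have g2 := le_sub_of_strictMono hA (i := i) (j := ⟨c - 1, by omega⟩)
        (by rw [Fin.le_def]; simp only; omega)
      have b1 := hb ⟨0, by omega⟩
      have b2 := hb ⟨c - 1, by omega⟩
      simp only [he]
      push_cast at g1 g2
      omega
  | succ T ih =>
    obtain ⟨κ, hκ, ih⟩ := ih
    -- The new factor is the one from `det_shifted_vandermonde` with `α = T + 1 - f` and `β = f + c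
    -- - 1`, the weights that `pointWeight_step` attaches to a down and an up step.
    refine ⟨κ * ∏ j : Fin c, ((T : ℝ) + c - (j : ℕ)), mul_pos hκ (prod_pos fun j _ => ?_),
      fun A hA => ?_⟩
    · have : ((j : ℕ) : ℝ) < c := by exact_mod_cast j.2
      have : (0 : ℝ) ≤ T := by positivity
      linarith
    · rw [card_walk_succ hA]
      have h1 : ∀ ε : Fin c → Bool, (Fintype.card (Walk f T (stepped A ε)) : ℝ) =
          κ * ((∏ i, pointWeight c f (T + 1) (A i)) *
            ((Matrix.of fun i (j : Fin c) => (stepped A ε i : ℝ) ^ (j : ℕ)).det *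
              ∏ i, (if ε i then ((f : ℝ) + c - 1 - A i) else ((T : ℝ) + 1 - f + A i)))) := by
        intro ε
        have hv : (Matrix.of fun i (j : Fin c) => (stepped A ε i : ℝ) ^ (j : ℕ)) =
          Matrix.vandermonde fun i => (stepped A ε i : ℝ) := rfl
        rw [hv]
        by_cases hm : StrictMono (stepped A ε)
        · rw [ih _ hm]
          simp only [stepped, pointWeight_step, prod_mul_distrib]
          ring
        · have := isEmpty_walk (f := f) (T := T) hm
          rw [Fintype.card_eq_zero, Nat.cast_zero, vandermonde_stepped_eq_zero hA hm]
          ring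
      have h2 := sum_prod_mul_det
        (fun i s => if s then ((f : ℝ) + c - 1 - A i) else ((T : ℝ) + 1 - f + A i))
        (fun i s j => ((A i + if s then 1 else 0 : ℤ) : ℝ) ^ (j : ℕ))
      have h3 := det_shifted_vandermonde ((T : ℝ) + 1 - f) ((f : ℝ) + c - 1) (fun i => (A i : ℝ))
      simp only [h1, ← mul_sum, stepped, h2]
      simp only [Fintype.sum_bool, if_true, Bool.false_eq_true, if_false, Int.cast_add,
        Int.cast_one, Int.cast_zero, add_zero]
      have h4 : (Matrix.of fun i (j : Fin c) => ((f : ℝ) + c - 1 - A i) * ((A i : ℝ) + 1) ^ (j : ℕ) +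
          ((T : ℝ) + 1 - f + A i) * (A i : ℝ) ^ (j : ℕ)) =
          Matrix.of fun i (j : Fin c) => ((T : ℝ) + 1 - f + A i) * (A i : ℝ) ^ (j : ℕ) +
          ((f : ℝ) + c - 1 - A i) * ((A i : ℝ) + 1) ^ (j : ℕ) := by
        ext i j
        simp only [Matrix.of_apply]
        ring
      rw [h4, h3]
      have h5 : ∏ j : Fin c, ((T : ℝ) + 1 - f + ((f : ℝ) + c - 1) - (j : ℕ)) =
          ∏ j : Fin c, ((T : ℝ) + c - (j : ℕ)) := prod_congr rfl fun j _ => by ring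
      rw [h5]
      ring

end Walks

/-! ### Starting points with one gap -/

section Gap

/-- Deleting the node `p` from `0, …, c` removes the factors `|i - p|`, whose product is `p! (c -
p)!`. -/
lemma vandermonde_succAbove (c : ℕ) (p : Fin (c + 1)) :
    (Matrix.vandermonde fun i : Fin c => ((p.succAbove i : ℕ) : ℝ)).det *
      ((p : ℕ).factorial * (c - p).factorial) =
    (Matrix.vandermonde fun i : Fin (c + 1) => ((i : ℕ) : ℝ)).det := by
  have key : ∀ (d : ℕ) (v : Fin d → ℝ), (Matrix.vandermonde v).det =
      ∏ i, ∏ j, if i < j then v j - v i else 1 := by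
    intro d v
    rw [Matrix.det_vandermonde]
    refine prod_congr rfl fun i _ => ?_
    rw [← prod_filter]
    congr 1
    ext j
    simp
  rw [key, key, Fin.prod_univ_succAbove _ p, Fin.prod_univ_succAbove _ p]
  simp only [Fin.prod_univ_succAbove _ p (n := c), lt_self_iff_false, if_false, one_mul,
    prod_mul_distrib, Fin.succAbove_lt_succAbove_iff]
  refine Eq.trans ?_ (mul_assoc _ _ _)
  rw [← prod_mul_distrib, mul_comm]
  congr 1
  have h1 : ∀ i : Fin c, ((if p < p.succAbove i then ((p.succAbove i : ℕ) : ℝ) - (p : ℕ) else 1) *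
      if p.succAbove i < p then ((p : ℕ) : ℝ) - (p.succAbove i : ℕ) else 1) =
      (fun k : ℕ => if k < p then ((p : ℕ) : ℝ) - k else (k : ℝ) + 1 - (p : ℕ)) i := by
    intro i
    simp only
    rcases lt_or_ge (i : ℕ) p with h | h
    · have h' : i.castSucc < p := h
      rw [Fin.succAbove_of_castSucc_lt _ _ h', if_neg h'.not_gt, if_pos h', if_pos h]
      simp
    · have h' : p ≤ i.castSucc := h
      have h2 : p < i.succ := lt_of_le_of_lt h' Fin.castSucc_lt_succ
      rw [Fin.succAbove_of_le_castSucc _ _ h', if_pos h2, if_neg h2.not_gt, if_neg (by omega)]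
      simp
  rw [prod_congr rfl fun i _ => h1 i, Fin.prod_univ_eq_prod_range (fun k : ℕ =>
    if k < (p : ℕ) then ((p : ℕ) : ℝ) - k else (k : ℝ) + 1 - (p : ℕ))]
  have hp := p.2
  obtain ⟨q, hq⟩ : ∃ q, c = p + q := ⟨c - p, by omega⟩
  generalize (p : ℕ) = r at *
  subst hq
  rw [prod_range_add, Nat.add_sub_cancel_left]
  congr 1
  · rw [← prod_range_add_one_eq_factorial, ← prod_range_reflect]
    push_cast
    refine prod_congr rfl fun k hk => ?_
    rw [mem_range] at hk
    rw [if_pos hk, Nat.cast_sub (by omega), Nat.cast_sub (by omega)]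
    push_cast
    ring
  · rw [← prod_range_add_one_eq_factorial]
    push_cast
    refine prod_congr rfl fun k _ => ?_
    rw [if_neg (by omega)]
    ring

/-- From a packed start, a path going up forces all paths above it up, so `ε` is a threshold and one
gap opens. -/
lemma exists_succAbove_of_strictMono {c : ℕ} {ε : Fin c → Bool}
    (h : StrictMono (stepped (fun i : Fin c => ((i : ℕ) : ℤ)) ε)) :
    ∃ p : Fin (c + 1), ε = fun i => decide (p ≤ i.castSucc) := by
  have hmono : ∀ i j, i ≤ j → ε i = true → ε j = true := by
    intro i j hij hi
    have h1 := le_sub_of_strictMono h hij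
    simp only [stepped, hi, if_true] at h1
    by_contra hj
    rw [if_neg hj] at h1
    omega
  by_cases hex : ∃ i, ε i = true
  · have hne : (univ.filter fun i => ε i = true).Nonempty := by
      obtain ⟨i, hi⟩ := hex
      exact ⟨i, by simpa using hi⟩
    set q := (univ.filter fun i => ε i = true).min' hne with hq
    have hq1 : ε q = true := by
      have := min'_mem _ hne
      rw [mem_filter] at this
      exact this.2
    refine ⟨q.castSucc, funext fun i => ?_⟩
    rw [Bool.eq_iff_iff, decide_eq_true_iff, Fin.castSucc_le_castSucc_iff]
    exact ⟨fun hi => min'_le _ _ (by simpa using hi), fun hi => hmono q i hi hq1⟩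
  · refine ⟨Fin.last c, funext fun i => ?_⟩
    have h1 : ε i = false := by
      by_contra hcon
      exact hex ⟨i, by simpa using hcon⟩
    rw [h1, eq_comm, decide_eq_false_iff_not, not_le]
    exact Fin.castSucc_lt_last i

lemma stepped_succAbove {c : ℕ} (p : Fin (c + 1)) :
    stepped (fun i : Fin c => ((i : ℕ) : ℤ)) (fun i => decide (p ≤ i.castSucc)) =
      fun i => ((p.succAbove i : ℕ) : ℤ) := by
  funext i
  simp only [stepped, decide_eq_true_eq]
  split_ifs with h
  · rw [Fin.succAbove_of_le_castSucc _ _ h]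
    simp
  · rw [Fin.succAbove_of_castSucc_lt _ _ (not_le.1 h)]
    simp

lemma sum_stepped {c : ℕ} (H : (Fin c → ℤ) → ℝ) (hH : ∀ A, ¬ StrictMono A → H A = 0) :
    ∑ ε : Fin c → Bool, H (stepped (fun i : Fin c => ((i : ℕ) : ℤ)) ε) =
      ∑ p : Fin (c + 1), H fun i => ((p.succAbove i : ℕ) : ℤ) := by
  symm
  refine Fintype.sum_of_injective (fun (p : Fin (c + 1)) i => decide (p ≤ i.castSucc)) ?_ _ _ ?_ ?_
  · have key : ∀ p q : Fin (c + 1), p < q →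
        (fun i : Fin c => decide (p ≤ i.castSucc)) ≠ fun i => decide (q ≤ i.castSucc) := by
      intro p q hpq h
      have hpc : (p : ℕ) < c := lt_of_lt_of_le hpq (Nat.lt_succ_iff.1 q.2)
      have h1 := congrFun h ⟨p, hpc⟩
      simp only [Fin.castSucc_mk, Fin.eta, le_refl, decide_true] at h1
      exact absurd (of_decide_eq_true h1.symm) (not_le.2 hpq)
    intro p q h
    rcases lt_trichotomy p q with hlt | heq | hgt
    · exact absurd h (key p q hlt)
    · exact heq
    · exact absurd h.symm (key q p hgt)
  · intro ε hε
    refine hH _ fun hm => hε ?_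
    obtain ⟨p, hp⟩ := exists_succAbove_of_strictMono hm
    exact ⟨p, hp.symm⟩
  · intro p
    rw [stepped_succAbove]

/-- The unnormalised distribution of the gap in column `1`. -/
def gapWeight (a b c p : ℕ) : ℝ :=
  ((a + c - 1 - p).factorial * (b - 1 + p).factorial : ℝ) / (p.factorial * (c - p).factorial)

lemma gapWeight_pos (a b c p : ℕ) : 0 < gapWeight a b c p := by
  unfold gapWeight
  positivity

lemma gapWeight_succ {a b c p : ℕ} (ha : 1 ≤ a) (hb : 1 ≤ b) (hp : p < c) :
    gapWeight a b c (p + 1) * (((p + 1 : ℕ) : ℝ) * (a + c - (p + 1 : ℕ))) =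
      gapWeight a b c p * ((b + p) * (c - p)) := by
  obtain ⟨a, rfl⟩ : ∃ a', a = a' + 1 := ⟨a - 1, by omega⟩
  obtain ⟨b, rfl⟩ : ∃ b', b = b' + 1 := ⟨b - 1, by omega⟩
  obtain ⟨q, rfl⟩ : ∃ q, c = p + 1 + q := ⟨c - (p + 1), by omega⟩
  simp only [gapWeight]
  rw [show a + 1 + (p + 1 + q) - 1 - (p + 1) = a + q by omega,
    show b + 1 - 1 + (p + 1) = (b + p) + 1 by omega,
    show p + 1 + q - (p + 1) = q by omega,
    show a + 1 + (p + 1 + q) - 1 - p = (a + q) + 1 by omega,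
    show b + 1 - 1 + p = b + p by omega,
    show p + 1 + q - p = q + 1 by omega]
  simp only [Nat.factorial_succ]
  push_cast
  have h1 : (p.factorial : ℝ) ≠ 0 := by exact_mod_cast p.factorial_ne_zero
  have h2 : (q.factorial : ℝ) ≠ 0 := by exact_mod_cast q.factorial_ne_zero
  field_simp
  ring

/-- Summed form of the ratio of consecutive weights; the boundary terms vanish because of the
factors `p` at `0` and `c - p` at `c`. -/
lemma sum_gapWeight_shift {a b c : ℕ} (ha : 1 ≤ a) (hb : 1 ≤ b) (g : ℕ → ℝ) :
    ∑ p ∈ range (c + 1), g p * (gapWeight a b c p * ((p : ℝ) * (a + c - p))) =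
      ∑ p ∈ range (c + 1), g (p + 1) * (gapWeight a b c p * ((b + p) * (c - p))) := by
  rw [sum_range_succ', sum_range_succ (fun p => g (p + 1) * _)]
  simp only [Nat.cast_zero, zero_mul, mul_zero, sub_self, add_zero]
  refine sum_congr rfl fun p hp => ?_
  rw [gapWeight_succ ha hb (mem_range.1 hp)]

/-- Test functions `1` and `p` in `sum_gapWeight_shift`. The highest powers of `p` cancel, leaving
linear relations for the first and second moments. -/
lemma gapWeight_moments {a b c : ℕ} (ha : 1 ≤ a) (hb : 1 ≤ b) :
    ((a : ℝ) + b) * ∑ p ∈ range (c + 1), gapWeight a b c p * p =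
      b * c * ∑ p ∈ range (c + 1), gapWeight a b c p ∧
    ((a : ℝ) + b + 1) * ∑ p ∈ range (c + 1), gapWeight a b c p * (p : ℝ) ^ 2 =
      b * c * ∑ p ∈ range (c + 1), gapWeight a b c p +
        (b * c + c - b) * ∑ p ∈ range (c + 1), gapWeight a b c p * p := by
  constructor
  · have h := sum_gapWeight_shift (c := c) ha hb fun _ => 1
    rw [← sub_eq_zero, ← sum_sub_distrib] at h
    rw [mul_sum, mul_sum, ← sub_eq_zero, ← sum_sub_distrib, ← h]
    exact sum_congr rfl fun p _ => by ring
  · have h := sum_gapWeight_shift (c := c) ha hb fun p => p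
    rw [← sub_eq_zero, ← sum_sub_distrib] at h
    rw [mul_sum, mul_sum, mul_sum, ← sum_add_distrib, ← sub_eq_zero, ← sum_sub_distrib, ← h]
    refine sum_congr rfl fun p _ => ?_
    push_cast
    ring

end Gap

/-! ### The variance of the height of the first column -/

section FirstColumn

variable {a b c : ℕ}

/-- A routing seen as a family of walks. -/
def routingEquivWalk (a b c : ℕ) :
    Routing a b c ≃ Walk (c := c) a (a + b) fun i => ((i : ℕ) : ℤ) where
  toFun u := ⟨fun x i => u.1 i x, funext u.2.start, funext fun i =>
    (u.2.finish i).trans (add_comm _ _), fun x i => u.2.step i x, fun x i j h => u.2.disjoint i j h x⟩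
  invFun w := ⟨fun i x => w.1 x i, fun i => congrFun w.2.1 i, fun i => by
    rw [congrFun w.2.2.1 i, add_comm], fun i x => w.2.2.2.1 x i, fun _ _ h x => w.2.2.2.2 x h⟩
  left_inv _ := rfl
  right_inv _ := rfl

lemma sum_walk_first {f : ℤ} {T m : ℕ} (hT : T = m + 1) {A : Fin c → ℤ} (hA : StrictMono A)
    (h1 : 1 < T + 1) (G : (Fin c → ℤ) → ℝ) :
    ∑ w : Walk f T A, G (w.1 ⟨1, h1⟩) =
      ∑ ε : Fin c → Bool, Fintype.card (Walk f m (stepped A ε)) * G (stepped A ε) := by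
  subst hT
  exact sum_walk_succ hA G

lemma strictMono_natCast : StrictMono fun i : Fin c => ((i : ℕ) : ℤ) := fun i j h => by
  have : (i : ℕ) < j := h
  simpa using this

/-- Column `1` is `{0, …, c}` without `p`. The continuations are counted by `card_walk_eq`; relative
to the full set the Vandermonde loses `p! (c - p)!` and the product loses the weight of `p`, and the
quotient is `gapWeight`. -/
lemma sum_routing_first (ha : 1 ≤ a) (hb : 1 ≤ b) : ∃ κ : ℝ, 0 < κ ∧
    ∀ G : (Fin c → ℤ) → ℝ, ∑ u : Routing a b c, G (fun i => u.1 i ⟨1, by omega⟩) =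
      κ * ∑ p : Fin (c + 1), gapWeight a b c p * G fun i => ((p.succAbove i : ℕ) : ℤ) := by
  obtain ⟨m, hm⟩ : ∃ m, a + b = m + 1 := ⟨a + b - 1, by omega⟩
  obtain ⟨κ, hκ, hcard⟩ := card_walk_eq (c := c) a m
  set V := (Matrix.vandermonde fun i : Fin (c + 1) => ((i : ℕ) : ℝ)).det with hV
  have hVpos : 0 < V := vandermonde_det_pos fun i j h => by
    have : (i : ℕ) < j := h
    exact_mod_cast this
  have hpw : ∀ i : Fin (c + 1), pointWeight c a m ((i : ℕ) : ℤ) =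
      1 / ((a + c - 1 - i).factorial * (b - 1 + i).factorial : ℝ) := by
    intro i
    have := i.2
    rw [pointWeight, show (a : ℤ) + c - 1 - (i : ℕ) = ((a + c - 1 - i : ℕ) : ℤ) by omega,
      show (m : ℤ) - a + (i : ℕ) = ((b - 1 + i : ℕ) : ℤ) by omega, invFactorial_natCast,
      invFactorial_natCast, one_div_mul_one_div]
  set Q := ∏ i : Fin (c + 1), pointWeight c a m ((i : ℕ) : ℤ) with hQ
  have hQpos : 0 < Q := prod_pos fun i _ => by rw [hpw]; positivity
  refine ⟨κ * V * Q, by positivity, fun G => ?_⟩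
  rw [← (routingEquivWalk a b c).symm.sum_comp]
  have h1 := sum_walk_first (f := a) hm (strictMono_natCast (c := c)) (by omega) G
  refine Eq.trans h1 ?_
  rw [sum_stepped (fun A => (Fintype.card (Walk a m A) : ℝ) * G A) fun A hA => by
    have := isEmpty_walk (f := a) (T := m) hA
    rw [Fintype.card_eq_zero, Nat.cast_zero, zero_mul], mul_sum]
  refine sum_congr rfl fun p _ => ?_
  have h2 := vandermonde_succAbove c p
  have h3 := Fin.prod_univ_succAbove (fun i : Fin (c + 1) => pointWeight c a m ((i : ℕ) : ℤ)) p
  rw [← hV] at h2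
  rw [← hQ, hpw p] at h3
  rw [hcard _ fun i j h => by
    have : p.succAbove i < p.succAbove j := Fin.strictMono_succAbove p h
    exact_mod_cast this, ← h2, h3, gapWeight]
  simp only [Int.cast_natCast]
  have e1 : ((p : ℕ).factorial : ℝ) ≠ 0 := by positivity
  have e2 : ((c - p : ℕ).factorial : ℝ) ≠ 0 := by positivity
  have e3 : ((a + c - 1 - p : ℕ).factorial : ℝ) ≠ 0 := by positivity
  have e4 : ((b - 1 + p : ℕ).factorial : ℝ) ≠ 0 := by positivity
  field_simp

lemma columnHeightNat_one (ha : 1 ≤ a) (u : Routing a b c) :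
    columnHeightNat 1 u =
      ((∑ i, (fun i => u.1 i ⟨1, by omega⟩ : Fin c → ℤ) i : ℤ) : ℝ) - c / 2 := by
  rw [columnHeightNat, dif_pos (by omega)]
  simp only [columnHeight, height, sum_sub_distrib, sum_const, card_univ, Fintype.card_fin,
    nsmul_eq_mul]
  push_cast
  ring

lemma sum_succAbove (p : Fin (c + 1)) :
    ((∑ i : Fin c, ((p.succAbove i : ℕ) : ℤ) : ℤ) : ℝ) =
      ∑ i : Fin (c + 1), ((i : ℕ) : ℝ) - (p : ℕ) := by
  rw [Fin.sum_univ_succAbove _ p]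
  push_cast
  ring

lemma heightCov_one_one (ha : 1 ≤ a) (hb : 1 ≤ b) :
    heightCov a b c 1 1 = Fintype.card (Routing a b c) *
      ((a : ℝ) * b * c * (a + b + c) / ((a + b) ^ 2 * (a + b + 1))) := by
  obtain ⟨κ, hκ, hG⟩ := sum_routing_first (c := c) ha hb
  -- The total height in column `1` is `s - p`, so its variance is that of the gap `p`.
  set s : ℝ := ∑ i : Fin (c + 1), ((i : ℕ) : ℝ) - c / 2 with hs
  have hsum : ∀ F : ℝ → ℝ, ∑ u : Routing a b c, F (columnHeightNat 1 u) =
      κ * ∑ p ∈ range (c + 1), gapWeight a b c p * F (s - p) := by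
    intro F
    have h := hG fun A => F (((∑ i, A i : ℤ) : ℝ) - c / 2)
    simp only [sum_succAbove] at h
    rw [← Fin.sum_univ_eq_sum_range (fun p : ℕ => gapWeight a b c p * F (s - p))]
    simp only [columnHeightNat_one ha]
    rw [h]
    congr 1
    refine sum_congr rfl fun p _ => ?_
    rw [hs]
    congr 2
    ring
  obtain ⟨m1, m2⟩ := gapWeight_moments (c := c) ha hb
  set M0 := ∑ p ∈ range (c + 1), gapWeight a b c p with hM0
  set M1 := ∑ p ∈ range (c + 1), gapWeight a b c p * p with hM1
  set M2 := ∑ p ∈ range (c + 1), gapWeight a b c p * (p : ℝ) ^ 2 with hM2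
  have hM0pos : 0 < M0 := sum_pos (fun p _ => gapWeight_pos a b c p) ⟨0, by simp⟩
  have hcard : (Fintype.card (Routing a b c) : ℝ) = κ * M0 := by
    have := hsum fun _ => 1
    simpa using this
  have hmean : mean (columnHeightNat (a := a) (b := b) (c := c) 1) = s - M1 / M0 := by
    have h := hsum fun r => r
    have h' : ∑ p ∈ range (c + 1), gapWeight a b c p * (s - p) = s * M0 - M1 := by
      rw [hM0, hM1, mul_sum, ← sum_sub_distrib]
      exact sum_congr rfl fun p _ => by ring
    rw [mean, h, h', hcard]
    field_simp
  have hcov : heightCov a b c 1 1 = κ * (M2 - M1 ^ 2 / M0) := by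
    have h := hsum fun r => (r - (s - M1 / M0)) * (r - (s - M1 / M0))
    rw [heightCov]
    simp only [centredHeight, hmean]
    rw [h]
    have h' : ∑ p ∈ range (c + 1), gapWeight a b c p *
        ((s - p - (s - M1 / M0)) * (s - p - (s - M1 / M0))) =
        M2 - 2 * (M1 / M0) * M1 + (M1 / M0) ^ 2 * M0 := by
      rw [hM2, hM1, hM0, mul_sum, mul_sum, ← hM1, ← hM0, ← sum_sub_distrib, ← sum_add_distrib]
      exact sum_congr rfl fun p _ => by ring
    rw [h']
    field_simp
    ring
  rw [hcov, hcard]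
  have ha' : (0 : ℝ) < a := by exact_mod_cast ha
  have hb' : (0 : ℝ) < b := by exact_mod_cast hb
  have e1 : M1 = b * c * M0 / (a + b) := by
    rw [eq_div_iff (by positivity), ← m1]
    ring
  have e2 : M2 = (b * c * M0 + (b * c + c - b) * M1) / (a + b + 1) := by
    rw [eq_div_iff (by positivity), ← m2]
    ring
  rw [e2, e1]
  field_simp
  ring

end FirstColumn

/-! ### Eigenvalues of monotone and of lazy chains -/

section Abstract

variable {X : Type*} [Fintype X]

/-- Let `L` be the Lipschitz constant of `f` relative to `φ` over comparable pairs. Then `L • φ ± f`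
are monotone, hence so are their images `lam L • φ ± nu • f`. At a pair attaining `L` this reads
`|nu| L ≤ lam L`. -/
lemma abs_le_of_monotone_chain [PartialOrder X] [OrderTop X] {P : Matrix X X ℝ}
    (hP : ∀ f : X → ℝ, Monotone f → Monotone (P.mulVec f)) {φ : X → ℝ} (hφ : StrictMono φ)
    {lam : ℝ} (hlam : P.mulVec φ = lam • φ) {f : X → ℝ} {nu : ℝ} (hf : P.mulVec f = nu • f)
    (hne : ∃ x y, f x ≠ f y) : |nu| ≤ lam := by
  classical
  -- The greatest element supplies a comparable pair on which `f` differs, so that `L` is positive.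
  obtain ⟨x₀, hx₀⟩ : ∃ x, f x ≠ f ⊤ := by
    by_contra! h
    obtain ⟨x, y, hxy⟩ := hne
    exact hxy ((h x).trans (h y).symm)
  set S : Finset (X × X) := univ.filter fun p => p.1 < p.2 with hS
  have hx₀S : (x₀, ⊤) ∈ S := by
    rw [hS, mem_filter]
    exact ⟨mem_univ _, lt_top_iff_ne_top.2 fun h => hx₀ (congrArg f h)⟩
  obtain ⟨p, hp, hmax⟩ := exists_max_image S
    (fun p => |f p.2 - f p.1| / (φ p.2 - φ p.1)) ⟨_, hx₀S⟩
  set L := |f p.2 - f p.1| / (φ p.2 - φ p.1) with hL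
  have hpos : ∀ q ∈ S, 0 < φ q.2 - φ q.1 := fun q hq => by
    rw [hS, mem_filter] at hq
    exact sub_pos.2 (hφ hq.2)
  have hL0 : 0 < L := by
    refine lt_of_lt_of_le ?_ (hmax _ hx₀S)
    exact div_pos (abs_pos.2 (sub_ne_zero.2 hx₀.symm)) (hpos _ hx₀S)
  have hbound : ∀ x y, x ≤ y → |f y - f x| ≤ L * (φ y - φ x) := by
    intro x y hxy
    rcases hxy.eq_or_lt with rfl | hlt
    · simp
    · have hq : (x, y) ∈ S := by rw [hS, mem_filter]; exact ⟨mem_univ _, hlt⟩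
      have := hmax _ hq
      rwa [div_le_iff₀ (hpos _ hq)] at this
  have hplus : Monotone (L • φ + f) := fun x y hxy => by
    have := neg_le_of_abs_le (hbound x y hxy)
    simp only [Pi.add_apply, Pi.smul_apply, smul_eq_mul]
    linarith
  have hminus : Monotone (L • φ - f) := fun x y hxy => by
    have := le_of_abs_le (hbound x y hxy)
    simp only [Pi.sub_apply, Pi.smul_apply, smul_eq_mul]
    linarith
  have hple : p.1 ≤ p.2 := by
    rw [hS, mem_filter] at hp
    exact hp.2.le
  have h1 := hP _ hplus hple
  have h2 := hP _ hminus hple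
  rw [Matrix.mulVec_add, Matrix.mulVec_smul, hlam, hf] at h1
  rw [Matrix.mulVec_sub, Matrix.mulVec_smul, hlam, hf] at h2
  simp only [Pi.add_apply, Pi.sub_apply, Pi.smul_apply, smul_eq_mul] at h1 h2
  have hd := hpos p hp
  have hLd : |f p.2 - f p.1| = L * (φ p.2 - φ p.1) := by
    rw [hL]
    field_simp
  have h3 : |nu| * (L * (φ p.2 - φ p.1)) ≤ lam * (L * (φ p.2 - φ p.1)) := by
    rw [← hLd, ← abs_mul, hLd, abs_le]
    constructor <;> nlinarith
  exact le_of_mul_le_mul_right h3 (mul_pos hL0 hd)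

/-- Gershgorin argument at a point where `|f|` is maximal: the diagonal entry outweighs the rest of
its row. -/
lemma nonneg_of_lazy_chain {P : Matrix X X ℝ} (h0 : ∀ x y, 0 ≤ P x y)
    (h1 : P.mulVec (fun _ => 1) = fun _ => 1) (hlazy : ∀ x, 1 / 2 ≤ P x x) {f : X → ℝ} {nu : ℝ}
    (hf : P.mulVec f = nu • f) (hne : f ≠ 0) : 0 ≤ nu := by
  classical
  obtain ⟨x₁, hx₁⟩ := Function.ne_iff.1 hne
  obtain ⟨x, -, hx⟩ := exists_max_image univ (fun x => |f x|) ⟨x₁, mem_univ _⟩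
  have hM : 0 < |f x| := (abs_pos.2 hx₁).trans_le (hx x₁ (mem_univ _))
  have hrow : ∑ y, P x y = 1 := by
    have := congrFun h1 x
    simpa [Matrix.mulVec, dotProduct] using this
  have heq : ∑ y, P x y * (f y * f x) = nu * |f x| ^ 2 := by
    have := congrFun hf x
    simp only [Matrix.mulVec, dotProduct, Pi.smul_apply, smul_eq_mul] at this
    rw [sq_abs, sq, ← mul_assoc, ← this, sum_mul]
    exact sum_congr rfl fun y _ => by ring
  rw [← add_sum_erase _ _ (mem_univ x)] at hrow heq
  have hlow : ∑ y ∈ univ.erase x, P x y * (-|f x| ^ 2) ≤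
      ∑ y ∈ univ.erase x, P x y * (f y * f x) := by
    refine sum_le_sum fun y _ => mul_le_mul_of_nonneg_left ?_ (h0 x y)
    have h2 : |f y * f x| ≤ |f x| ^ 2 := by
      rw [abs_mul, sq]
      exact mul_le_mul_of_nonneg_right (hx y (mem_univ _)) (abs_nonneg _)
    exact neg_le_of_abs_le h2
  rw [← sum_mul] at hlow
  have hsq : f x * f x = |f x| ^ 2 := by rw [sq_abs, sq]
  rw [hsq] at heq
  have h3 : 0 ≤ nu * |f x| ^ 2 := by
    rw [← heq]
    have := hlazy x
    nlinarith [sq_nonneg |f x|]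
  exact nonneg_of_mul_nonneg_left h3 (by positivity)

/-! ### The constant of the separation distance -/

variable [DecidableEq X]

lemma mulVec_pow_of_eigen {P : Matrix X X ℝ} {f : X → ℝ} {nu : ℝ} (hf : P.mulVec f = nu • f)
    (t : ℕ) : (P ^ t).mulVec f = nu ^ t • f := by
  induction t with
  | zero => simp
  | succ t ih =>
    rw [pow_succ, ← Matrix.mulVec_mulVec, hf, Matrix.mulVec_smul, ih, smul_smul, pow_succ,
      mul_comm]

lemma isLittleO_pow_mulVec {P : Matrix X X ℝ} (hP : P.IsHermitian) {lam : ℝ} {r : X → ℝ}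
    (h : ∀ (f : X → ℝ) (nu : ℝ), P.mulVec f = nu • f → f ≠ 0 →
      ∑ x, f x * r x = 0 ∨ (0 ≤ nu ∧ nu < lam)) (x : X) :
    (fun t : ℕ => (P ^ t).mulVec r x) =o[atTop] fun t : ℕ => lam ^ t := by
  set e := hP.eigenvectorBasis
  have hr : r = ∑ k, (∑ y, e k y * r y) • (e k : X → ℝ) := by
    have h1 := e.sum_repr' (WithLp.toLp 2 r)
    have h2 := congrArg WithLp.ofLp h1
    rw [WithLp.ofLp_sum] at h2
    simp only [WithLp.ofLp_smul] at h2
    refine h2.symm.trans (sum_congr rfl fun k _ => ?_)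
    congr 1
    rw [EuclideanSpace.inner_eq_star_dotProduct]
    simp [dotProduct, mul_comm]
  have hpow : ∀ t : ℕ, (P ^ t).mulVec r x =
      ∑ k, (∑ y, e k y * r y) * (hP.eigenvalues k ^ t * e k x) := by
    intro t
    conv_lhs => rw [hr]
    rw [Matrix.mulVec_sum, Finset.sum_apply]
    refine sum_congr rfl fun k _ => ?_
    rw [Matrix.mulVec_smul, mulVec_pow_of_eigen (hP.mulVec_eigenvectorBasis k)]
    rfl
  simp only [hpow]
  refine IsLittleO.fun_sum fun k _ => ?_
  have hk : (e k : X → ℝ) ≠ 0 := by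
    intro h0
    apply e.orthonormal.ne_zero k
    ext y
    exact congrFun h0 y
  rcases h _ _ (hP.mulVec_eigenvectorBasis k) hk with h0 | ⟨h0, h1⟩
  · have h0' : ∑ y, e k y * r y = 0 := h0
    simp only [h0', zero_mul]
    exact isLittleO_zero _ _
  · have h2 := isLittleO_pow_pow_of_lt_left h0 h1
    have h3 := h2.const_mul_left ((∑ y, e k y * r y) * e k x)
    refine h3.congr_left fun t => ?_
    ring

lemma isSeparationConstant_of_simple [Nonempty X] {P : Matrix X X ℝ} (hP : P.IsSymm)
    (hone : P.mulVec (fun _ => 1) = fun _ => 1) {φ : X → ℝ} {lam : ℝ}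
    (hφ : P.mulVec φ = lam • φ) (hsum : ∑ x, φ x = 0) (hlam : 0 ≤ lam)
    (hspec : ∀ (f : X → ℝ) (nu : ℝ), P.mulVec f = nu • f → f ≠ 0 →
      (∃ s : ℝ, f = fun _ => s) ∨ (∃ s : ℝ, f = s • φ) ∨ (0 ≤ nu ∧ nu < lam))
    {M : ℝ} (hM : 0 < M) (hle : ∀ x, |φ x| ≤ M) {p q : X} (hp : φ p = M) (hq : φ q = -M) :
    IsSeparationConstant P lam (M ^ 2 / variance φ) := by
  have hmean : mean φ = 0 := by rw [mean, hsum, zero_div]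
  have hcard : (0 : ℝ) < Fintype.card X := by exact_mod_cast Fintype.card_pos
  have hS : 0 < ∑ x, φ x ^ 2 :=
    sum_pos' (fun x _ => sq_nonneg _) ⟨p, mem_univ _, by rw [hp]; positivity⟩
  have hvar : variance φ = (∑ x, φ x ^ 2) / Fintype.card X := by
    simp only [variance, hmean, sub_zero]
    rfl
  have hvarpos : 0 < variance φ := by rw [hvar]; positivity
  -- The point mass at `y` minus its projections to the constants and to `φ`; only eigenvalues below
  -- `lam` act on what remains.
  set r : X → X → ℝ := fun y => Pi.single y 1 - (fun _ => 1 / (Fintype.card X : ℝ)) -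
    (φ y / ∑ x, φ x ^ 2) • φ with hr
  have hr1 : ∀ y, ∑ x, r y x = 0 := by
    intro y
    simp only [hr, Pi.sub_apply, Pi.smul_apply, smul_eq_mul, sum_sub_distrib, ← mul_sum, hsum,
      sum_pi_single', mem_univ, if_true, sum_const, card_univ, nsmul_eq_mul]
    field_simp
    ring
  have hr2 : ∀ y, ∑ x, φ x * r y x = 0 := by
    intro y
    simp only [hr, Pi.sub_apply, Pi.smul_apply, smul_eq_mul, mul_sub, sum_sub_distrib, ← sum_mul,
      hsum, zero_mul, sub_zero]
    have e1 : ∑ x, φ x * (Pi.single y 1 : X → ℝ) x = φ y := by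
      simp [Pi.single_apply]
    have e2 : ∑ x, φ x * (φ y / (∑ x, φ x ^ 2) * φ x) = φ y := by
      calc _ = φ y / (∑ x, φ x ^ 2) * ∑ x, φ x ^ 2 := by
            rw [mul_sum]
            exact sum_congr rfl fun x _ => by ring
        _ = φ y := by field_simp
    rw [e1, e2, sub_self]
  have hdecay : ∀ y x, (fun t : ℕ => (P ^ t).mulVec (r y) x) =o[atTop] fun t : ℕ => lam ^ t := by
    intro y x
    have hH : P.IsHermitian := by
      rw [Matrix.IsHermitian, Matrix.conjTranspose_eq_transpose_of_trivial]
      exact hP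
    refine isLittleO_pow_mulVec hH (fun f nu hf hne => ?_) x
    rcases hspec f nu hf hne with ⟨s, rfl⟩ | ⟨s, rfl⟩ | h
    · left
      rw [← mul_sum, hr1, mul_zero]
    · left
      simp only [Pi.smul_apply, smul_eq_mul, mul_assoc]
      rw [← mul_sum, hr2, mul_zero]
    · exact Or.inr h
  have hentry : ∀ (t : ℕ) (x y : X),
      (1 / (Fintype.card X : ℝ) - (P ^ t) x y) / (1 / (Fintype.card X : ℝ)) =
      -(φ x * φ y / variance φ) * lam ^ t + -Fintype.card X * (P ^ t).mulVec (r y) x := by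
    intro t x y
    have hsplit : (Pi.single y 1 : X → ℝ) = r y + (1 / (Fintype.card X : ℝ)) • (fun _ => (1 : ℝ)) +
        (φ y / ∑ x, φ x ^ 2) • φ := by
      funext x
      simp only [hr, Pi.add_apply, Pi.sub_apply, Pi.smul_apply, smul_eq_mul]
      ring
    have h1 : (P ^ t) x y = (P ^ t).mulVec (Pi.single y 1) x := by
      rw [Matrix.mulVec_single_one]
      rfl
    have hone' : P.mulVec (fun _ => (1 : ℝ)) = (1 : ℝ) • fun _ => (1 : ℝ) := by
      rw [one_smul]; exact hone
    rw [h1, hsplit, Matrix.mulVec_add, Matrix.mulVec_add, Matrix.mulVec_smul, Matrix.mulVec_smul,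
      mulVec_pow_of_eigen hφ, mulVec_pow_of_eigen hone', one_pow, one_smul, hvar]
    simp only [Pi.add_apply, Pi.smul_apply, smul_eq_mul]
    field_simp
    ring
  have hAle : ∀ x y, -(φ x * φ y / variance φ) ≤ M ^ 2 / variance φ := by
    intro x y
    rw [← neg_div]
    refine div_le_div_of_nonneg_right ?_ hvarpos.le
    have h1 : |φ x * φ y| ≤ M ^ 2 := by
      rw [abs_mul, sq]
      exact mul_le_mul (hle x) (hle y) (abs_nonneg _) hM.le
    linarith [neg_le_of_abs_le h1]
  have hApq : -(φ p * φ q / variance φ) = M ^ 2 / variance φ := by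
    rw [hp, hq]
    ring
  set A := M ^ 2 / variance φ with hA
  have hApos : 0 < A := by positivity
  set E : X × X → ℕ → ℝ := fun z t => -Fintype.card X * (P ^ t).mulVec (r z.2) z.1 with hE
  -- The error is kept additive, without dividing by `lam ^ t`: `lam` may be `0`, as for `a = b = c
  -- = 1`.
  have hElit : (fun t => ∑ z, |E z t|) =o[atTop] fun t : ℕ => lam ^ t := by
    refine IsLittleO.fun_sum fun z _ => ?_
    exact ((hdecay z.2 z.1).const_mul_left _).abs_left
  have hdist : ∀ t, |separation P t - A * lam ^ t| ≤ ∑ z, |E z t| := by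
    intro t
    have hEle : ∀ z, |E z t| ≤ ∑ z, |E z t| := fun z =>
      single_le_sum (f := fun z => |E z t|) (fun _ _ => abs_nonneg _) (mem_univ z)
    have hpow : 0 ≤ lam ^ t := pow_nonneg hlam t
    rw [abs_le]
    constructor
    · have h1 : (1 / (Fintype.card X : ℝ) - (P ^ t) p q) / (1 / (Fintype.card X : ℝ)) ≤
          separation P t :=
        le_sup' (fun z : X × X => (1 / (Fintype.card X : ℝ) - (P ^ t) z.1 z.2) /
          (1 / (Fintype.card X : ℝ))) (mem_univ (p, q))
      rw [hentry, hApq] at h1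
      have h2 := hEle (p, q)
      have h3 := neg_abs_le (E (p, q) t)
      simp only [hE] at h2 h3 ⊢
      linarith
    · rw [sub_le_iff_le_add]
      refine sup'_le _ _ fun z _ => ?_
      rw [hentry]
      have h1 := mul_le_mul_of_nonneg_right (hAle z.1 z.2) hpow
      have h2 := hEle z
      have h3 := le_abs_self (E z t)
      simp only [hE] at h2 h3 ⊢
      linarith
  rw [IsSeparationConstant, abs_of_nonneg hlam]
  refine IsLittleO.trans_isBigO (g := fun t : ℕ => lam ^ t) ?_ ?_
  · refine IsBigO.trans_isLittleO (IsBigO.of_norm_le fun t => ?_) hElit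
    exact hdist t
  · exact (isBigO_refl _ _).const_mul_right hApos.ne' |>.trans (isBigO_refl _ _)

end Abstract

/-! ### The Luby-Randall-Sinclair chain -/

section Final

variable {a b c : ℕ}

/-- The Green constant is the column `1` variance divided by `a + b - 1`, by `heightCov_one` at `y =
1`; it is then inserted into `sum_potential_sq`. -/
lemma variance_potential (ha : 1 ≤ a) (hb : 1 ≤ b) :
    variance (fun u : Routing a b c => potential u) =
      c * (a * b * (a + b + c)) /
        (4 * (1 - Real.cos (Real.pi / ((a : ℝ) + b))) * (((a : ℝ) + b) ^ 2 - 1)) := by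
  obtain ⟨m, hm⟩ : ∃ m, a + b = m + 1 := ⟨a + b - 1, by omega⟩
  have h1m : 1 ≤ m := by omega
  have hm' : (a : ℝ) + b = m + 1 := by exact_mod_cast hm
  have h1m' : (1 : ℝ) ≤ m := by exact_mod_cast h1m
  have hcos := one_sub_cos_pos h1m
  have hsq := sum_potential_sq (c := c) hm h1m
  have h11 := heightCov_one_one (c := c) ha hb
  rw [heightCov_one le_rfl (by omega), hm] at h11
  have hcard := card_routing_pos (a := a) (b := b) (c := c)
  have hmean : mean (fun u : Routing a b c => potential u) = 0 := by
    rw [mean, sum_potential, zero_div]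
  have hvar : variance (fun u : Routing a b c => potential u) =
      (∑ u : Routing a b c, potential u ^ 2) / Fintype.card (Routing a b c) := by
    simp only [variance, hmean, sub_zero]
    rfl
  rw [hvar]
  rw [hm] at hsq
  rw [hm'] at h11 ⊢
  have hH : heightCov a b c 1 (m + 1 - 1) = Fintype.card (Routing a b c) *
      ((a : ℝ) * b * c * (m + 1 + c) / ((m + 1) ^ 2 * (m + 1 + 1))) / m := by
    rw [← h11]
    push_cast
    field_simp
    ring
  rw [hH] at hsq
  have hS : ∑ u : Routing a b c, potential u ^ 2 = ((m : ℝ) + 1) ^ 2 / 2 *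
      (Fintype.card (Routing a b c) *
        ((a : ℝ) * b * c * (m + 1 + c) / ((m + 1) ^ 2 * (m + 1 + 1))) / m) /
      (2 - 2 * Real.cos (Real.pi / (m + 1))) := by
    rw [eq_div_iff (by linarith), ← hsq]
    ring
  rw [hS, show (2 - 2 * Real.cos (Real.pi / ((m : ℝ) + 1))) =
    2 * (1 - Real.cos (Real.pi / (m + 1))) by ring,
    show ((m : ℝ) + 1) ^ 2 - 1 = m * (m + 1 + 1) by ring]
  have := hcos.ne'
  field_simp
  ring

lemma potential_top_eq (ha : 1 ≤ a) (hb : 1 ≤ b) :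
    potential (⊤ : Routing a b c) = c * Real.sin (Real.pi * a / ((a : ℝ) + b)) /
      (2 * (1 - Real.cos (Real.pi / ((a : ℝ) + b)))) := by
  obtain ⟨m, hm⟩ : ∃ m, a + b = m + 1 := ⟨a + b - 1, by omega⟩
  have hm' : (a : ℝ) + b = m + 1 := by exact_mod_cast hm
  have hcos := one_sub_cos_pos (show 1 ≤ m by omega)
  have h := potential_top (c := c) hm ha hb
  rw [hm', eq_div_iff (by positivity), mul_div_right_comm]
  linarith

lemma cos_lt_one_of_pos (ha : 1 ≤ a) (hb : 1 ≤ b) :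
    0 < 1 - Real.cos (Real.pi / ((a : ℝ) + b)) := by
  obtain ⟨m, hm⟩ : ∃ m, a + b = m + 1 := ⟨a + b - 1, by omega⟩
  have hm' : (a : ℝ) + b = m + 1 := by exact_mod_cast hm
  rw [hm']
  exact one_sub_cos_pos (by omega)

lemma potential_top_pos (ha : 1 ≤ a) (hb : 1 ≤ b) (hc : 1 ≤ c) :
    0 < potential (⊤ : Routing a b c) := by
  have h1 := cos_lt_one_of_pos ha hb
  have ha' : (0 : ℝ) < a := by exact_mod_cast ha
  have hb' : (0 : ℝ) < b := by exact_mod_cast hb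
  have hc' : (0 : ℝ) < c := by exact_mod_cast hc
  have h2 : 0 < Real.sin (Real.pi * a / ((a : ℝ) + b)) := by
    apply Real.sin_pos_of_pos_of_lt_pi (by positivity)
    rw [div_lt_iff₀ (by positivity)]
    exact mul_lt_mul_of_pos_left (by linarith) Real.pi_pos
  rw [potential_top_eq ha hb]
  positivity

lemma isSeparationConstant_transition (ha : 1 ≤ a) (hb : 1 ≤ b) (hc : 1 ≤ c) {lam : ℝ}
    (h2 : IsSecondEigenvalue (transition a b c) lam)
    (hmult : HasMultiplicityOne (transition a b c) lam) :
    IsSeparationConstant (transition a b c) lam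
      (potential (⊤ : Routing a b c) ^ 2 / variance (fun u : Routing a b c => potential u)) := by
  have hN := card_sites_pos ha hb hc
  obtain ⟨m, hm⟩ : ∃ m, a + b = m + 1 := ⟨a + b - 1, by omega⟩
  have hφ := transition_mulVec_potential (c := c) hN hm
  have hone := transition_mulVec_const (a := a) (b := b) (c := c) hN 1
  have htop := potential_top_pos ha hb hc
  have hbot := potential_bottom_eq_neg_top (c := c) ha hb
  have hnonneg : ∀ (f : Routing a b c → ℝ) (nu : ℝ), (transition a b c).mulVec f = nu • f →
      f ≠ 0 → 0 ≤ nu := fun f nu hf hne =>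
    nonneg_of_lazy_chain (fun _ _ => transition_nonneg) hone (fun _ => half_le_transition_self hN)
      hf hne
  have hbound : ∀ (f : Routing a b c → ℝ) (nu : ℝ), (transition a b c).mulVec f = nu • f →
      (∃ x y, f x ≠ f y) → |nu| ≤ potentialEigenvalue a b c := fun f nu hf hne =>
    abs_le_of_monotone_chain (fun _ => transition_mulVec_mono) potential_strictMono hφ hf hne
  have hφ0 : (potential : Routing a b c → ℝ) ≠ 0 := fun h => htop.ne' (congrFun h ⊤)
  have hlt : potentialEigenvalue a b c < 1 := by
    have := div_pos (cos_lt_one_of_pos ha hb) hN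
    rw [potentialEigenvalue]
    linarith
  obtain ⟨hev, hne1, hmax⟩ := h2
  -- An eigenvector for `lam ≠ 1` is not constant, so monotonicity bounds `lam` above. Maximality of
  -- `|lam|` against the eigenvalue of `potential`, which is less than `1`, gives the converse. Both
  -- are nonnegative.
  have hlam : lam = potentialEigenvalue a b c := by
    obtain ⟨f, hf⟩ := hev.exists_hasEigenvector
    have hf1 : (transition a b c).mulVec f = lam • f := by
      have := hf.apply_eq_smul
      rwa [Matrix.toLin'_apply] at this
    have hfne : f ≠ 0 := hf.2
    have hconst : ∃ x y, f x ≠ f y := by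
      by_contra! hcon
      have hfc : f = fun _ => f ⊤ := funext fun x => hcon x ⊤
      rw [hfc, transition_mulVec_const hN] at hf1
      have h1 := congrFun hf1 ⊤
      simp only [Pi.smul_apply, smul_eq_mul] at h1
      have h3 : f ⊤ ≠ 0 := fun h => hfne (by rw [hfc, h]; rfl)
      exact hne1 (mul_right_cancel₀ h3 (by rw [one_mul]; exact h1.symm))
    have hle := hbound f lam hf1 hconst
    have h0 := hnonneg f lam hf1 hfne
    have hφev : Module.End.HasEigenvalue (Matrix.toLin' (transition a b c))
        (potentialEigenvalue a b c) :=
      Module.End.hasEigenvalue_of_hasEigenvector (x := potential)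
        ⟨Module.End.mem_eigenspace_iff.2 (by rw [Matrix.toLin'_apply]; exact hφ), hφ0⟩
    have hge := hmax _ hφev hlt.ne
    have h0' := hnonneg _ _ hφ hφ0
    rw [abs_of_nonneg h0] at hle hge
    rw [abs_of_nonneg h0'] at hge
    exact le_antisymm hle hge
  subst hlam
  have hsimple : ∀ f : Routing a b c → ℝ,
      (transition a b c).mulVec f = potentialEigenvalue a b c • f → ∃ s : ℝ, f = s • potential := by
    intro f hf
    have hmem : ∀ g : Routing a b c → ℝ,
        (transition a b c).mulVec g = potentialEigenvalue a b c • g →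
        g ∈ Module.End.eigenspace (Matrix.toLin' (transition a b c))
          (potentialEigenvalue a b c) := fun g hg =>
      Module.End.mem_eigenspace_iff.2 (by rw [Matrix.toLin'_apply]; exact hg)
    have h3 := (finrank_eq_one_iff_of_nonzero' (⟨potential, hmem _ hφ⟩ :
      Module.End.eigenspace (Matrix.toLin' (transition a b c)) (potentialEigenvalue a b c))
      (fun h => hφ0 (congrArg Subtype.val h))).1 hmult ⟨f, hmem _ hf⟩
    obtain ⟨s, hs⟩ := h3
    exact ⟨s, (congrArg Subtype.val hs).symm⟩
  refine isSeparationConstant_of_simple transition_isSymm hone hφ sum_potential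
    (hnonneg _ _ hφ hφ0) (fun f nu hf hne => ?_) htop (fun u => ?_) (p := ⊤)
    (q := bottomRouting a b c) rfl hbot
  · by_cases hconst : ∃ x y, f x ≠ f y
    · right
      have h1 := hbound f nu hf hconst
      have h0 := hnonneg f nu hf hne
      rw [abs_of_nonneg h0] at h1
      rcases h1.eq_or_lt with h | h
      · left
        rw [h] at hf
        exact hsimple f hf
      · exact Or.inr ⟨h0, h⟩
    · push Not at hconst
      exact Or.inl ⟨f ⊤, funext fun x => hconst x ⊤⟩
  · have h3 := potential_strictMono.monotone (le_top : u ≤ ⊤)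
    have h4 := potential_strictMono.monotone (bottomRouting_le u)
    rw [hbot] at h4
    exact abs_le.2 ⟨h4, h3⟩

end Final

end LozengeChain

end

theorem theorem10p2 (a b c : ℕ) (ha : 1 ≤ a) (hb : 1 ≤ b) (hc : 1 ≤ c) :
    (∀ lam : ℝ,
      LozengeChain.IsSecondEigenvalue (LozengeChain.transition a b c) lam →
      LozengeChain.HasMultiplicityOne (LozengeChain.transition a b c) lam →
      LozengeChain.IsSeparationConstant (LozengeChain.transition a b c) lam
        (LozengeChain.potential (⊤ : LozengeChain.Routing a b c) ^ 2 /
          LozengeChain.variance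
            (fun u : LozengeChain.Routing a b c => LozengeChain.potential u))) ∧
    LozengeChain.potential (⊤ : LozengeChain.Routing a b c) ^ 2 /
        LozengeChain.variance (fun u : LozengeChain.Routing a b c => LozengeChain.potential u) =
      ((c : ℝ) * (((a : ℝ) + b) ^ 2 - 1)) / ((a : ℝ) * b * ((a : ℝ) + b + c)) *
        (Real.sin (Real.pi * a / ((a : ℝ) + b)) ^ 2 /
          (1 - Real.cos (Real.pi / ((a : ℝ) + b)))) := by
  refine ⟨fun lam h2 hmult => LozengeChain.isSeparationConstant_transition ha hb hc h2 hmult, ?_⟩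
  rw [LozengeChain.variance_potential ha hb, LozengeChain.potential_top_eq ha hb]
  have hcos := (LozengeChain.cos_lt_one_of_pos ha hb).ne'
  have ha' : (1 : ℝ) ≤ a := by exact_mod_cast ha
  have hb' : (1 : ℝ) ≤ b := by exact_mod_cast hb
  have hc' : (1 : ℝ) ≤ c := by exact_mod_cast hc
  have hn : ((a : ℝ) + b) ^ 2 - 1 ≠ 0 := by nlinarith
  field_simp
  ring
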